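/- Let $k$ be a field. A continuous quiver of type $A$ consists of a subset $S\subset\mathbb R$ without accumulation points (possibly empty, finite or infinite) and an order-preserving indexing $n\mapsto s_n$ of $S\cup\{\pm\infty\}$ by a subset of $\mathbb Z\cup\{\pm\infty\}$ that is convex and contains $0$. It carries the partial order $\preceq$ on $\mathbb R$ in which $x$ and $y$ are comparable if and only if they lie in a common segment $[s_n,s_{n+1}]$, $n\in\mathbb Z$, and in which $\preceq$ on this segment is the usual order $\le$ if $n$ is even and the opposite order if $n$ is odd; thus the $s_n\in S$ with $n$ even are sinks and those with $n$ odd are sources. A representation $V$ of the quiver over $k$ consists of a $k$-vector space $V(x)$ for every $x\in\mathbb R$ and a $k$-linear map $V(x,y)\colon V(x)\to V(y)$ for all $y\preceq x$, such that $V(x,x)=\mathrm{id}$ and $V(y,z)\circ V(x,y)=V(x,z)$ whenever $z\preceq y\preceq x$; it is pointwise finite-dimensional if $\dim_k V(x)<\infty$ for all $x$. For an interval (i.e. a nonempty connected subset, bounded or not, open, closed or half-open, possibly one point) $I\subseteq\mathbb R$ let $M_I$ be the representation with $M_I(x)=k$ for $x\in I$ and $M_I(x)=0$ otherwise, and with $M_I(x,y)=\mathrm{id}_k$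 if $y\preceq x$ and $x,y\in I$, and $M_I(x,y)=0$ otherwise. Theorem. Let $V$ be a pointwise finite-dimensional representation over $k$ of a continuous quiver of type $A$. Then $V$ is a direct sum of interval indecomposables: there is a family $(I_j)_{j\in J}$ of intervals in $\mathbb R$ such that every $M_{I_j}$ is indecomposable and $V\cong\bigoplus_{j\in J}M_{I_j}$. -/

import Mathlib

open Set Filter Topology

universe u v w

/-- The set `S̄ = S ∪ {-∞, +∞}`, inside the extended real line. -/
def extendedSet (S : Set ℝ) : Set EReal :=
  ((fun x : ℝ => (x : EReal)) '' S) ∪ {⊥, ⊤}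

/-- The set `ℤ ∪ {-∞, +∞}` of possible indices, with its usual order. -/
abbrev ExtInt : Type := WithBot (WithTop ℤ)

/-- An integer as an index. -/
def ExtInt.ofInt (n : ℤ) : ExtInt := ((n : WithTop ℤ) : WithBot (WithTop ℤ))

/-- A continuous quiver of type `A`: a set `S` of real numbers without accumulation points, and an
order preserving indexing `n ↦ s n` of `S ∪ {-∞, +∞}` by a convex subset of `ℤ ∪ {-∞, +∞}` that
contains `0`. The elements of `S` with even index are the sinks and those with odd index the
sources; see `ContinuousQuiver.le` for the orientation this gives. -/
structure ContinuousQuiver where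
  /-- The set of sinks and sources. -/
  S : Set ℝ
  /-- `S` has no accumulation point in `ℝ`. -/
  not_accPt : ∀ x : ℝ, ¬ AccPt x (𝓟 S)
  /-- The set of indices that occur. -/
  N : Set ExtInt
  zero_mem : ExtInt.ofInt 0 ∈ N
  convex : N.OrdConnected
  /-- The element `s n` of `S ∪ {-∞, +∞}` with index `n`. -/
  s : N ≃o extendedSet S

namespace ContinuousQuiver

variable (A : ContinuousQuiver)

/-- `A.Segment n x` says that `n` and `n + 1` are indices and that `s n ≤ x ≤ s (n + 1)`. -/
def Segment (n : ℤ) (x : ℝ) : Prop :=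
  ∃ (h : ExtInt.ofInt n ∈ A.N) (h' : ExtInt.ofInt (n + 1) ∈ A.N),
    (A.s ⟨ExtInt.ofInt n, h⟩ : EReal) ≤ (x : EReal) ∧
      (x : EReal) ≤ (A.s ⟨ExtInt.ofInt (n + 1), h'⟩ : EReal)

/-- The orientation `x ⪯ y`: the points `x` and `y` lie in a common closed segment
`[s n, s (n + 1)]`, and there `⪯` is the usual order if `n` is even (so that `s n` is a sink, i.e.
minimal) and the opposite order if `n` is odd (so that `s n` is a source, i.e. maximal). -/
def le (x y : ℝ) : Prop :=
  ∃ n : ℤ, A.Segment n x ∧ A.Segment n y ∧ ((Even n ∧ x ≤ y) ∨ (Odd n ∧ y ≤ x))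

theorem ofInt_le_ofInt {m n : ℤ} : ExtInt.ofInt m ≤ ExtInt.ofInt n ↔ m ≤ n := by
  simp [ExtInt.ofInt]

theorem ofInt_lt_ofInt {m n : ℤ} : ExtInt.ofInt m < ExtInt.ofInt n ↔ m < n := by
  simp [ExtInt.ofInt]

theorem bot_mem_extendedSet (S : Set ℝ) : (⊥ : EReal) ∈ extendedSet S := by
  simp [extendedSet]

theorem top_mem_extendedSet (S : Set ℝ) : (⊤ : EReal) ∈ extendedSet S := by
  simp [extendedSet]

theorem finite_inter_Icc (a b : ℝ) : (A.S ∩ Icc a b).Finite := by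
  by_contra h
  have h : (A.S ∩ Icc a b).Infinite := h
  obtain ⟨x, -, hx⟩ := h.exists_accPt_of_subset_isCompact isCompact_Icc inter_subset_right
  exact A.not_accPt x (hx.mono (by simp))

theorem s_le_s {m n : ExtInt} (hm : m ∈ A.N) (hn : n ∈ A.N) :
    (A.s ⟨m, hm⟩ : EReal) ≤ A.s ⟨n, hn⟩ ↔ m ≤ n := by
  rw [Subtype.coe_le_coe, A.s.le_iff_le, Subtype.mk_le_mk]

theorem s_lt_s {m n : ExtInt} (hm : m ∈ A.N) (hn : n ∈ A.N) :
    (A.s ⟨m, hm⟩ : EReal) < A.s ⟨n, hn⟩ ↔ m < n := by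
  rw [Subtype.coe_lt_coe, A.s.lt_iff_lt, Subtype.mk_lt_mk]

theorem s_mem_S {n : ExtInt} (hn : n ∈ A.N) {a b : EReal} (ha : a < A.s ⟨n, hn⟩)
    (hb : A.s ⟨n, hn⟩ < b) : ∃ r ∈ A.S, (A.s ⟨n, hn⟩ : EReal) = (r : ℝ) := by
  rcases (A.s ⟨n, hn⟩).2 with ⟨r, hr, h⟩ | h | h
  · exact ⟨r, hr, h.symm⟩
  · exact absurd (h ▸ ha) not_lt_bot
  · have h : (A.s ⟨n, hn⟩ : EReal) = ⊤ := h
    exact absurd (h ▸ hb) not_top_lt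

/-- Infinitely many elements of `S` cannot lie in a bounded region. -/
theorem not_bounded_seq (a b : ℝ) (f : ℕ → ExtInt) (hf : Function.Injective f)
    (hN : ∀ n, f n ∈ A.N) (h : ∀ n, ∃ r ∈ A.S, (A.s ⟨f n, hN n⟩ : EReal) = (r : ℝ) ∧ a ≤ r ∧ r ≤ b) :
    False := by
  choose r hr hs ha hb using h
  have hinj : Function.Injective r := by
    intro m n hmn
    have : (A.s ⟨f m, hN m⟩ : EReal) = A.s ⟨f n, hN n⟩ := by rw [hs, hs, hmn]
    have := A.s.injective (Subtype.ext this)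
    exact hf (congrArg Subtype.val this)
  refine (Set.infinite_of_injective_forall_mem hinj (s := A.S ∩ Icc a b) ?_)
    (A.finite_inter_Icc a b)
  exact fun n => ⟨hr n, ha n, hb n⟩

theorem exists_s_le (x : ℝ) :
    ∃ (n : ℤ) (h : ExtInt.ofInt n ∈ A.N), (A.s ⟨_, h⟩ : EReal) ≤ (x : EReal) := by
  obtain ⟨⟨p, hp⟩, hps⟩ := A.s.surjective ⟨⊥, bot_mem_extendedSet _⟩
  have hp0 : p ≤ ExtInt.ofInt 0 := by
    rw [← A.s_le_s hp A.zero_mem, hps]; exact bot_le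
  induction p using WithBot.recBotCoe with
  | coe q =>
    induction q using WithTop.recTopCoe with
    | top =>
      simp only [ExtInt.ofInt, WithBot.coe_le_coe, top_le_iff] at hp0
      exact absurd hp0 (WithTop.coe_ne_top)
    | coe n => exact ⟨n, hp, by erw [hps]; exact bot_le⟩
  | bot =>
    by_contra! hc
    have hN : ∀ n : ℤ, n ≤ 0 → ExtInt.ofInt n ∈ A.N := fun n hn =>
      A.convex.out hp A.zero_mem ⟨bot_le, ofInt_le_ofInt.2 hn⟩
    have hlt : ∀ n : ℕ, (A.s ⟨_, hN (-(n + 1)) (by omega)⟩ : EReal) < A.s ⟨_, A.zero_mem⟩ := by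
      intro n
      rw [s_lt_s, ofInt_lt_ofInt]; omega
    have hex := fun n : ℕ => A.s_mem_S (hN (-(n + 1)) (by omega)) (hc _ _) (hlt n)
    obtain ⟨b, -, hb⟩ := hex 0
    refine A.not_bounded_seq x b (fun n => ExtInt.ofInt (-(n + 1))) ?_
      (fun n => hN (-(n + 1)) (by omega)) ?_
    · intro m n hmn
      have := ofInt_le_ofInt.1 (le_of_eq hmn)
      have := ofInt_le_ofInt.1 (ge_of_eq hmn)
      omega
    · intro n
      obtain ⟨r, hr, hs⟩ := hex n
      refine ⟨r, hr, hs, ?_, ?_⟩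
      · have := hc _ (hN (-(n + 1)) (by omega))
        rw [hs] at this
        exact_mod_cast this.le
      · rw [← EReal.coe_le_coe_iff, ← hs, ← hb, s_le_s, ofInt_le_ofInt]
        push_cast; omega

theorem exists_lt_s (x : ℝ) :
    ∃ (n : ℤ) (h : ExtInt.ofInt n ∈ A.N), (x : EReal) < (A.s ⟨_, h⟩ : EReal) := by
  obtain ⟨⟨p, hp⟩, hps⟩ := A.s.surjective ⟨⊤, top_mem_extendedSet _⟩
  have hp0 : ExtInt.ofInt 0 ≤ p := by
    rw [← A.s_le_s A.zero_mem hp, hps]; exact le_top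
  induction p using WithBot.recBotCoe with
  | bot => simp [ExtInt.ofInt] at hp0
  | coe q =>
    induction q using WithTop.recTopCoe with
    | coe n => exact ⟨n, hp, by erw [hps]; exact EReal.coe_lt_top x⟩
    | top =>
      by_contra! hc
      have hN : ∀ n : ℤ, 0 ≤ n → ExtInt.ofInt n ∈ A.N := fun n hn =>
        A.convex.out A.zero_mem hp ⟨ofInt_le_ofInt.2 hn, le_top⟩
      have hlt : ∀ n : ℕ, (A.s ⟨_, A.zero_mem⟩ : EReal) < A.s ⟨_, hN (n + 1) (by omega)⟩ := by
        intro n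
        rw [s_lt_s, ofInt_lt_ofInt]; omega
      have hex := fun n : ℕ => A.s_mem_S (hN (n + 1) (by omega)) (hlt n)
        ((hc _ _).trans_lt (EReal.coe_lt_top x))
      obtain ⟨b, -, hb⟩ := hex 0
      refine A.not_bounded_seq b x (fun n => ExtInt.ofInt (n + 1)) ?_
        (fun n => hN (n + 1) (by omega)) ?_
      · intro m n hmn
        have := ofInt_le_ofInt.1 (le_of_eq hmn)
        have := ofInt_le_ofInt.1 (ge_of_eq hmn)
        omega
      · intro n
        obtain ⟨r, hr, hs⟩ := hex n
        refine ⟨r, hr, hs, ?_, ?_⟩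
        · rw [← EReal.coe_le_coe_iff, ← hs, ← hb, s_le_s, ofInt_le_ofInt]
          push_cast; omega
        · have := hc _ (hN (n + 1) (by omega))
          rw [hs] at this
          exact_mod_cast this

/-- Every real number lies in one of the closed segments. -/
theorem exists_segment (x : ℝ) : ∃ n : ℤ, A.Segment n x := by
  obtain ⟨a, ha, hax⟩ := A.exists_s_le x
  obtain ⟨b, hb, hxb⟩ := A.exists_lt_s x
  have hab : a < b := by
    rw [← ofInt_lt_ofInt, ← A.s_lt_s ha hb]; exact hax.trans_lt hxb
  have hN : ∀ n, a ≤ n → n ≤ b → ExtInt.ofInt n ∈ A.N := fun n h h' =>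
    A.convex.out ha hb ⟨ofInt_le_ofInt.2 h, ofInt_le_ofInt.2 h'⟩
  by_contra! hc
  have key : ∀ n, a ≤ n → ∀ h : ExtInt.ofInt n ∈ A.N, n ≤ b →
      (A.s ⟨_, h⟩ : EReal) ≤ (x : EReal) := by
    intro n hn
    induction n, hn using Int.leInduction with
    | base => exact fun _ _ => hax
    | succ n hn ih =>
      intro h hnb
      by_contra! hlt
      exact hc n ⟨hN n hn (by omega), h, ih _ (by omega), hlt.le⟩
  exact absurd (key b hab.le hb le_rfl) (not_le.2 hxb)

theorem segment_succ {m n : ℤ} (hmn : m < n) {y : ℝ} (hm : A.Segment m y)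
    (hn : A.Segment n y) :
    n = m + 1 ∧ (∀ z, A.Segment m z → z ≤ y) ∧ (∀ z, A.Segment n z → y ≤ z) := by
  obtain ⟨_, h1, _, h2⟩ := hm
  obtain ⟨h3, _, h4, _⟩ := hn
  have h5 : n ≤ m + 1 := by
    rw [← ofInt_le_ofInt, ← A.s_le_s h3 h1]; exact h4.trans h2
  obtain rfl : n = m + 1 := by omega
  refine ⟨rfl, ?_, ?_⟩
  · rintro z ⟨_, _, _, hz⟩
    exact_mod_cast hz.trans h4
  · rintro z ⟨_, _, hz, _⟩
    exact_mod_cast h2.trans hz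

protected theorem le_refl (x : ℝ) : A.le x x := by
  obtain ⟨n, hn⟩ := A.exists_segment x
  exact ⟨n, hn, hn, (Int.even_or_odd n).imp (fun h => ⟨h, le_rfl⟩) fun h => ⟨h, le_rfl⟩⟩

/-- If `x ⪯ y ⪯ z`, then `x ⪯ z` and `y` lies between `x` and `z` on the real line. -/
theorem le_trans_and_mem {x y z : ℝ} (h : A.le x y) (h' : A.le y z) :
    A.le x z ∧ y ∈ uIcc x z := by
  have h₀ := h
  have h₀' := h'
  obtain ⟨m, hmx, hmy, hm⟩ := h
  obtain ⟨n, hny, hnz, hn⟩ := h'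
  rcases lt_trichotomy m n with hmn | rfl | hmn
  · obtain ⟨rfl, h1, h2⟩ := A.segment_succ hmn hmy hny
    have := h1 x hmx
    have := h2 z hnz
    rcases hm with ⟨he, hxy⟩ | ⟨ho, hxy⟩
    · rcases hn with ⟨he', hyz⟩ | ⟨ho', hyz⟩
      · exact absurd he (by simpa using (Int.even_add_one.1 he'))
      · obtain rfl : y = z := by linarith
        exact ⟨h₀, right_mem_uIcc⟩
    · obtain rfl : y = x := by linarith
      exact ⟨h₀', left_mem_uIcc⟩
  · rcases hm with ⟨he, hxy⟩ | ⟨ho, hxy⟩ <;> rcases hn with ⟨he', hyz⟩ | ⟨ho', hyz⟩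
    · exact ⟨⟨m, hmx, hnz, Or.inl ⟨he, hxy.trans hyz⟩⟩, mem_uIcc.2 (Or.inl ⟨hxy, hyz⟩)⟩
    · exact absurd he (Int.not_even_iff_odd.2 ho')
    · exact absurd he' (Int.not_even_iff_odd.2 ho)
    · exact ⟨⟨m, hmx, hnz, Or.inr ⟨ho, hyz.trans hxy⟩⟩, mem_uIcc.2 (Or.inr ⟨hyz, hxy⟩)⟩
  · obtain ⟨rfl, h1, h2⟩ := A.segment_succ hmn hny hmy
    have := h1 z hnz
    have := h2 x hmx
    rcases hm with ⟨he, hxy⟩ | ⟨ho, hxy⟩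
    · obtain rfl : y = x := by linarith
      exact ⟨h₀', left_mem_uIcc⟩
    · rcases hn with ⟨he', hyz⟩ | ⟨ho', hyz⟩
      · obtain rfl : y = z := by linarith
        exact ⟨h₀, right_mem_uIcc⟩
      · exact absurd ho (by simpa [Int.not_odd_iff_even] using ho'.add_one)

protected theorem le_trans {x y z : ℝ} (h : A.le x y) (h' : A.le y z) : A.le x z :=
  (A.le_trans_and_mem h h').1

protected theorem le_antisymm {x y : ℝ} (h : A.le x y) (h' : A.le y x) : x = y := by
  have := (A.le_trans_and_mem h h').2
  simpa [eq_comm] using this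

end ContinuousQuiver

/-- A representation `V` of the continuous quiver `A` over `k`: a vector space `V(x)` for each real
number `x` and a linear map `V(x, y) : V(x) → V(y)` whenever `y ⪯ x`, with `V(x, x) = id` and
`V(y, z) ∘ V(x, y) = V(x, z)`. -/
structure QuiverRep (k : Type u) [Field k] (A : ContinuousQuiver) where
  obj : ℝ → Type v
  [addCommGroup : ∀ x, AddCommGroup (obj x)]
  [module : ∀ x, Module k (obj x)]
  map : ∀ {x y : ℝ}, A.le y x → obj x →ₗ[k] obj y
  map_refl : ∀ x : ℝ, map (A.le_refl x) = LinearMap.id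
  map_comp : ∀ {x y z : ℝ} (h : A.le y x) (h' : A.le z y),
    map h' ∘ₗ map h = map (A.le_trans h' h)

namespace QuiverRep

attribute [instance] QuiverRep.addCommGroup QuiverRep.module

variable {k : Type u} [Field k] {A : ContinuousQuiver}

/-- An isomorphism of representations: linear isomorphisms at all points, compatible with the
structure maps. -/
structure Iso (V : QuiverRep.{u, v} k A) (W : QuiverRep.{u, w} k A) where
  equiv : ∀ x : ℝ, V.obj x ≃ₗ[k] W.obj x
  comm : ∀ {x y : ℝ} (h : A.le y x) (a : V.obj x),
    equiv y (V.map h a) = W.map h (equiv x a)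

/-- Pointwise finite-dimensional representations. -/
def IsPointwiseFinite (V : QuiverRep.{u, v} k A) : Prop :=
  ∀ x : ℝ, FiniteDimensional k (V.obj x)

/-- The zero representations. -/
def IsZero (V : QuiverRep.{u, v} k A) : Prop :=
  ∀ x : ℝ, Subsingleton (V.obj x)

/-- The direct sum of two representations, formed pointwise. -/
def prod (V W : QuiverRep.{u, v} k A) : QuiverRep.{u, v} k A where
  obj x := V.obj x × W.obj x
  map h := (V.map h).prodMap (W.map h)
  map_refl x := by rw [V.map_refl, W.map_refl, LinearMap.prodMap_id]
  map_comp h h' := by rw [LinearMap.prodMap_comp, V.map_comp, W.map_comp]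

/-- Indecomposable representations: nonzero, and not isomorphic to a direct sum of two nonzero
representations. -/
def IsIndecomposable (V : QuiverRep.{u, v} k A) : Prop :=
  ¬ V.IsZero ∧
    ∀ W₁ W₂ : QuiverRep.{u, v} k A, Nonempty (V.Iso (W₁.prod W₂)) → W₁.IsZero ∨ W₂.IsZero

/-- The direct sum of a family of representations, formed pointwise. -/
noncomputable def directSum {ι : Type w} (V : ι → QuiverRep.{u, v} k A) :
    QuiverRep.{u, max w v} k A where
  obj x := DirectSum ι fun i => (V i).obj x
  map h := DFinsupp.mapRange.linearMap fun i => (V i).map h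
  map_refl x := by
    ext i a : 2
    simp [(V _).map_refl]
  map_comp h h' := by
    rw [← DFinsupp.mapRange.linearMap_comp]
    simp only [map_comp]

section interval

variable (k) (A) (I : Set ℝ)

open scoped Classical in
/-- The space `M_I(x)`, which is `k` for `x ∈ I` and `0` otherwise. -/
noncomputable def intervalObj (x : ℝ) : Submodule k k :=
  if x ∈ I then ⊤ else ⊥

variable {I} in
theorem intervalObj_of_mem {x : ℝ} (h : x ∈ I) : intervalObj k I x = ⊤ := by
  simp [intervalObj, h]

variable {I} in
theorem intervalObj_eq_zero {x : ℝ} (h : x ∉ I) (a : intervalObj k I x) : (a : k) = 0 := by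
  have := a.2
  simpa [intervalObj, h] using this

open scoped Classical in
/-- The map `M_I(x) → M_I(y)`, which is the identity of `k` if `x, y ∈ I` and `0` otherwise. -/
noncomputable def intervalMap (x y : ℝ) : intervalObj k I x →ₗ[k] intervalObj k I y :=
  if h : x ∈ I ∧ y ∈ I then
    Submodule.inclusion (by rw [intervalObj_of_mem k h.1, intervalObj_of_mem k h.2])
  else 0

open scoped Classical in
theorem coe_intervalMap (x y : ℝ) (a : intervalObj k I x) :
    (intervalMap k I x y a : k) = if x ∈ I ∧ y ∈ I then (a : k) else 0 := by
  unfold intervalMap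
  split_ifs <;> rfl

/-- The representation `M_I` for an interval `I ⊆ ℝ`. -/
noncomputable def interval (hI : I.OrdConnected) : QuiverRep.{u, u} k A where
  obj x := intervalObj k I x
  map {x y} _ := intervalMap k I x y
  map_refl x := by
    ext a
    rw [coe_intervalMap]
    by_cases hx : x ∈ I
    · simp [hx]
    · simp [hx, intervalObj_eq_zero k hx a]
  map_comp {x y z} h h' := by
    ext a
    rw [LinearMap.comp_apply, coe_intervalMap, coe_intervalMap, coe_intervalMap]
    by_cases hxz : x ∈ I ∧ z ∈ I
    · have hy : y ∈ I := hI.uIcc_subset hxz.2 hxz.1 (A.le_trans_and_mem h' h).2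
      simp [hxz, hy]
    · grind

end interval

end QuiverRep

/-!
The argument only uses that the real line is a linear order with arrows between some of its points,
such that arrows factor through the points between their ends and any two points are joined by a
finite monotone chain of arrows (`Zigzag`, `ZigzagRep`). This generality is closed under reversing
the arrows, where a representation becomes its pointwise dual, and under reversing the linear order,
so a statement on extending vectors to the left also serves for functionals and to the right.

Fix a point `x` with `V x ≠ 0`. For `y ≤ x` consider the vectors in `V x` that extend to a section
over `[y, x]`, and those that extend to a section vanishing at `y`. All these subspaces together
form a chain (`isChain_chainAt`), and the points on the right of `x` give a second chain. Hence
there are a vector `v` and a functional `φ` with `φ v = 1` such that `φ` kills the members of both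
chains that do not contain `v` (`exists_dual_eq_one_of_isChain`). The position of `v` in the two
chains determines an interval `I` containing `x`. By linear compactness (`exists_pi_forall_eq`) `v`
extends to a homomorphism `M_I → V`, and, since a functional that kills one of the subspaces
extends to a section of the dual representation (`exists_dual_section`), `φ` extends to a
homomorphism `V → M_I`. Their composite is the identity, because it is so at `x`; so `M_I` is a
direct summand of `V` (`exists_interval_summand`).

Zorn's lemma is then applied to the pairs consisting of a set of independent interval
subrepresentations and a complement of their sum. Bounds of chains exist because everything is
finite-dimensional at each point, and a maximal pair has complement zero
(`exists_interval_basis`). Finally `M_I` is indecomposable because it is at most one-dimensional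
at each point and the points of `I` are connected by arrows (`isIndecomposable_interval`).
-/

/-! ### Linear algebra -/

/-- Two chains of subspaces of `M` admit a vector `v` and a functional `φ` with `φ v = 1` such that
`φ` kills every member of either chain that does not contain `v`. For `v` one takes an element of
the smallest nonzero member of `L`; the members of `R` that avoid `v` have a union avoiding `v`. -/
theorem exists_dual_eq_one_of_isChain {k : Type u} [Field k] {M : Type v} [AddCommGroup M]
    [Module k M] [FiniteDimensional k M] [Nontrivial M] {L R : Set (Submodule k M)}
    (hL : IsChain (· ≤ ·) L) (hR : IsChain (· ≤ ·) R) :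
    ∃ (v : M) (φ : Module.Dual k M), φ v = 1 ∧ ∀ N ∈ L ∪ R, v ∉ N → N ≤ LinearMap.ker φ := by
  obtain ⟨v, hv0, hv⟩ : ∃ v : M, v ≠ 0 ∧ ∀ N ∈ L, v ∉ N → N = ⊥ := by
    by_cases hne : ∃ N ∈ L, N ≠ ⊥
    · obtain ⟨N₀, ⟨hN₀L, hN₀⟩, hmin⟩ := WellFounded.has_min
        (wellFounded_lt (α := Submodule k M)) {N | N ∈ L ∧ N ≠ ⊥} hne
      obtain ⟨v, hvN, hv⟩ := Submodule.exists_mem_ne_zero_of_ne_bot hN₀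
      refine ⟨v, hv, fun N hN hvn => ?_⟩
      by_contra hb
      rcases hL.total hN hN₀L with h | h
      · exact hmin N ⟨hN, hb⟩ (lt_of_le_of_ne h fun e => hvn (e ▸ hvN))
      · exact hvn (h hvN)
    · push Not at hne
      obtain ⟨v, hv⟩ := exists_ne (0 : M)
      refine ⟨v, hv, fun N hN _ => hne N hN⟩
  have hsup : v ∉ sSup {N : Submodule k M | N ∈ R ∧ v ∉ N} := by
    rcases Set.eq_empty_or_nonempty {N : Submodule k M | N ∈ R ∧ v ∉ N} with h | h
    · rw [h]; simpa using hv0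
    · have hdir : IsChain (· ≤ ·) {N : Submodule k M | N ∈ R ∧ v ∉ N} :=
        hR.mono (Set.sep_subset _ _)
      intro hv
      obtain ⟨N, hN, hvN⟩ := (Submodule.mem_sSup_of_directed h hdir.directedOn).1 hv
      exact absurd hvN hN.2
  obtain ⟨f, hfv, hf⟩ := Submodule.exists_le_ker_of_notMem hsup
  refine ⟨v, (f v)⁻¹ • f, by simp [hfv], ?_⟩
  rintro N (hN | hN) hvN
  · simp [hv N hN hvN]
  · intro a ha
    have : f a = 0 := hf ((le_sSup ⟨hN, hvN⟩ : N ≤ sSup {N : Submodule k M | N ∈ R ∧ v ∉ N}) ha)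
    simp [this]

/-- Linear compactness: a system of linear equations `L s = c` in `s ∈ ∏ M x`, each involving only
finitely many coordinates, is solvable unless the equation `0 = 1` is a linear combination of them.
A functional separating `(0, 1)` from the equations gives an element of the double dual of each
`M x`. -/
theorem exists_pi_forall_eq {k : Type u} [Field k] {X : Type w} {M : X → Type v}
    [∀ x, AddCommGroup (M x)] [∀ x, Module k (M x)] [∀ x, FiniteDimensional k (M x)]
    (C : Set (Module.Dual k (∀ x, M x) × k))
    (hC : ∀ c ∈ C, c.1 ∈ Submodule.span k
      {L : Module.Dual k (∀ x, M x) | ∃ x, ∃ ξ : Module.Dual k (M x), L = ξ ∘ₗ LinearMap.proj x})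
    (h01 : ((0, 1) : Module.Dual k (∀ x, M x) × k) ∉ Submodule.span k C) :
    ∃ s : ∀ x, M x, ∀ c ∈ C, c.1 s = c.2 := by
  obtain ⟨g, hg1, hg⟩ := Submodule.exists_le_ker_of_notMem h01
  let f : Module.Dual k (∀ x, M x) →ₗ[k] k :=
    (-(g (0, 1))⁻¹) • (g ∘ₗ LinearMap.inl k (Module.Dual k (∀ x, M x)) k)
  have hf : ∀ c ∈ C, f c.1 = c.2 := by
    intro c hc
    have h1 : g c = 0 := hg (Submodule.subset_span hc)
    have h2 : c = (c.1, 0) + c.2 • ((0, 1) : Module.Dual k (∀ x, M x) × k) := by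
      ext <;> simp
    rw [h2, map_add, map_smul, smul_eq_mul] at h1
    have h3 : g (c.1, 0) = -(c.2 * g (0, 1)) := by linear_combination h1
    simp only [f, LinearMap.smul_apply, LinearMap.comp_apply, LinearMap.inl_apply, smul_eq_mul, h3]
    field_simp
  let s : ∀ x, M x := fun x =>
    (Module.evalEquiv k (M x)).symm (f ∘ₗ (LinearMap.proj x : (∀ x, M x) →ₗ[k] M x).dualMap)
  have hs : ∀ L ∈ Submodule.span k {L : Module.Dual k (∀ x, M x) |
      ∃ x, ∃ ξ : Module.Dual k (M x), L = ξ ∘ₗ LinearMap.proj x}, f L = L s := by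
    intro L hL
    induction hL using Submodule.span_induction with
    | mem L hL =>
      obtain ⟨x, ξ, rfl⟩ := hL
      simp only [LinearMap.comp_apply, LinearMap.proj_apply, s]
      rw [Module.apply_evalEquiv_symm_apply]
      rfl
    | zero => simp
    | add a b _ _ ha hb => simp [ha, hb]
    | smul c a _ ha => simp [ha]
  exact ⟨s, fun c hc => by rw [← hs _ (hC c hc), hf c hc]⟩

/-! ### Zigzag orientations of a linear order -/

/-- An orientation of a linear order by arrows: a reflexive and transitive relation such that an
arrow `x → z` factors through every point between `x` and `z`, and such that any two points are
connected by a finite monotone chain of points whose neighbours are joined by arrows. -/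
structure Zigzag (α : Type w) [LinearOrder α] where
  /-- `Arrow x y`: there is an arrow from `x` to `y`. -/
  Arrow : α → α → Prop
  refl : ∀ x, Arrow x x
  trans : ∀ {x y z}, Arrow x y → Arrow y z → Arrow x z
  of_mem_uIcc : ∀ {x y z}, Arrow x z → y ∈ uIcc x z → Arrow x y ∧ Arrow y z
  chain : ∀ {x y}, x ≤ y →
    Relation.ReflTransGen (fun a b => a ≤ b ∧ (Arrow a b ∨ Arrow b a)) x y

namespace Zigzag

variable {α : Type w} [LinearOrder α] (Z : Zigzag α)

/-- All arrows reversed. -/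
abbrev op : Zigzag α where
  Arrow x y := Z.Arrow y x
  refl := Z.refl
  trans h h' := Z.trans h' h
  of_mem_uIcc h h' := (Z.of_mem_uIcc h (by rwa [uIcc_comm])).symm
  chain h := Relation.ReflTransGen.mono (fun _ _ h => ⟨h.1, h.2.symm⟩) _ _ (Z.chain h)

/-- The same arrows on the reversed linear order. -/
abbrev mirror : Zigzag αᵒᵈ where
  Arrow x y := Z.Arrow (OrderDual.ofDual x) (OrderDual.ofDual y)
  refl _ := Z.refl _
  trans h h' := Z.trans h h'
  of_mem_uIcc {x y z} h h' := Z.of_mem_uIcc h (by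
    have h : (x ≤ y ∧ y ≤ z) ∨ (z ≤ y ∧ y ≤ x) := mem_uIcc.1 h'
    exact mem_uIcc.2 (h.symm.imp (fun h => ⟨h.2, h.1⟩) fun h => ⟨h.2, h.1⟩))
  chain {x y} h := by
    have := (Z.chain (x := OrderDual.ofDual y) (y := OrderDual.ofDual x) h)
    rw [← Relation.reflTransGen_swap] at this
    exact Relation.ReflTransGen.mono (fun a b h => ⟨h.1, h.2.symm⟩) _ _ this

variable {Z}

theorem arrow_of_mem_Icc {x y z : α} (h : Z.Arrow x z) (hy : y ∈ Icc x z) :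
    Z.Arrow x y ∧ Z.Arrow y z :=
  Z.of_mem_uIcc h (Icc_subset_uIcc hy)

theorem arrow_of_mem_Icc' {x y z : α} (h : Z.Arrow x z) (hy : y ∈ Icc z x) :
    Z.Arrow x y ∧ Z.Arrow y z :=
  Z.of_mem_uIcc h (Icc_subset_uIcc' hy)

/-- A function on an interval that is constant along arrows is constant. -/
theorem eq_of_arrow_eq {β : Type*} {I : Set α} (hI : I.OrdConnected) (f : α → β)
    (hf : ∀ p ∈ I, ∀ q ∈ I, Z.Arrow p q → f p = f q) {x y : α} (hx : x ∈ I) (hy : y ∈ I) :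
    f x = f y := by
  wlog hxy : x ≤ y generalizing x y
  · exact (this hy hx (le_of_not_ge hxy)).symm
  have key : x ≤ y ∧ f x = f y := by
    have hchain := Z.chain hxy
    suffices H : ∀ z, Relation.ReflTransGen (fun a b => a ≤ b ∧ (Z.Arrow a b ∨ Z.Arrow b a)) x z →
        x ≤ z ∧ (z ∈ I → f x = f z) from ⟨hxy, (H y hchain).2 hy⟩
    intro z hz
    induction hz with
    | refl => exact ⟨le_rfl, fun _ => rfl⟩
    | @tail b c _ hbc ih =>
      refine ⟨ih.1.trans hbc.1, fun hc => ?_⟩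
      have hb : b ∈ I := hI.out hx hc ⟨ih.1, hbc.1⟩
      rw [ih.2 hb]
      rcases hbc.2 with h | h
      · exact hf _ hb _ hc h
      · exact (hf _ hc _ hb h).symm
  exact key.2

end Zigzag

/-- A representation of an oriented linear order: vector spaces at the points and linear maps along
the arrows, compatible with composition. -/
structure ZigzagRep (k : Type u) [Field k] {α : Type w} [LinearOrder α] (Z : Zigzag α) where
  /-- The vector space at a point. -/
  obj : α → Type v
  [addCommGroup : ∀ x, AddCommGroup (obj x)]
  [module : ∀ x, Module k (obj x)]
  /-- The linear map along an arrow. -/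
  map : ∀ {x y : α}, Z.Arrow x y → obj x →ₗ[k] obj y
  map_refl : ∀ {x : α} (h : Z.Arrow x x) (a : obj x), map h a = a
  map_map : ∀ {x y z : α} (h : Z.Arrow x y) (h' : Z.Arrow y z) (a : obj x),
    map h' (map h a) = map (Z.trans h h') a

namespace ZigzagRep

attribute [instance] ZigzagRep.addCommGroup ZigzagRep.module

variable {k : Type u} [Field k] {α : Type w} [LinearOrder α] {Z : Zigzag α}
  (V : ZigzagRep.{u, v, w} k Z)

/-- The pointwise dual, a representation of the opposite orientation. -/
abbrev dual : ZigzagRep.{u, max u v, w} k Z.op where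
  obj x := Module.Dual k (V.obj x)
  map {x y} h := (V.map (x := y) (y := x) h).dualMap
  map_refl h φ := by
    ext a
    simp only [LinearMap.dualMap_apply]
    rw [V.map_refl]
  map_map h h' φ := by
    ext a
    simp only [LinearMap.dualMap_apply]
    rw [V.map_map]

/-- The same representation over the reversed linear order. -/
abbrev mirror : ZigzagRep.{u, v, w} k Z.mirror where
  obj x := V.obj (OrderDual.ofDual x)
  map {x y} h := V.map (x := OrderDual.ofDual x) (y := OrderDual.ofDual y) h
  map_refl h a := V.map_refl h a
  map_map h h' a := V.map_map h h' a

/-- The subrepresentation given by subspaces that are stable under all arrows. -/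
def sub (C : ∀ x, Submodule k (V.obj x))
    (hC : ∀ {x y : α} (h : Z.Arrow x y), ∀ a ∈ C x, V.map h a ∈ C y) :
    ZigzagRep.{u, v, w} k Z where
  obj x := C x
  map h := (V.map h).restrict (hC h)
  map_refl h a := Subtype.ext (V.map_refl h a)
  map_map h h' a := Subtype.ext (V.map_map h h' a)

/-! ### Sections -/

/-- The family `s` is compatible with all arrows inside `T` that start in `J`. For `J = univ` this
is a section over `T`. If `T` is everything and `s` is supported exactly on the interval `J`, then
it is a homomorphism from the interval representation on `J` to `V`: arrows leaving `J` send `s`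
to zero. -/
def IsSection (J T : Set α) (s : ∀ x, V.obj x) : Prop :=
  ∀ ⦃p q : α⦄ (h : Z.Arrow p q), p ∈ T → q ∈ T → p ∈ J → V.map h (s p) = s q

variable {V}

theorem IsSection.mono {J J' T T' : Set α} {s : ∀ x, V.obj x} (hs : V.IsSection J T s)
    (hJ : J' ⊆ J) (hT : T' ⊆ T) : V.IsSection J' T' s :=
  fun _ _ h hp hq hpJ => hs h (hT hp) (hT hq) (hJ hpJ)

/-- Two sections to the left and to the right of a point `z` that agree at `z` can be glued,
since every arrow across `z` factors through `z`. -/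
theorem IsSection.glue {J T₁ T₂ : Set α} {s t : ∀ x, V.obj x} {z : α}
    (hs : V.IsSection J T₁ s) (ht : V.IsSection J T₂ t) (h₁ : T₁ ⊆ Iic z) (h₂ : T₂ ⊆ Ici z)
    (hz₁ : z ∈ T₁) (hz₂ : z ∈ T₂) (hzJ : z ∈ J) (hst : s z = t z) :
    V.IsSection J (T₁ ∪ T₂) (fun p => if p ≤ z then s p else t p) := by
  have mem₁ : ∀ {p}, p ∈ T₁ ∪ T₂ → p ≤ z → p ∈ T₁ := by
    rintro p (hp | hp) h
    · exact hp
    · rwa [le_antisymm h (h₂ hp)]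
  have mem₂ : ∀ {p}, p ∈ T₁ ∪ T₂ → ¬ p ≤ z → p ∈ T₂ := by
    rintro p (hp | hp) h
    · exact absurd (h₁ hp) h
    · exact hp
  intro p q h hp hq hpJ
  dsimp only
  split_ifs with hpz hqz hqz
  · exact hs h (mem₁ hp hpz) (mem₁ hq hqz) hpJ
  · obtain ⟨h', h''⟩ := Zigzag.arrow_of_mem_Icc h ⟨hpz, (le_of_not_ge hqz)⟩
    rw [← ht h'' hz₂ (mem₂ hq hqz) hzJ, ← hst, ← hs h' (mem₁ hp hpz) hz₁ hpJ, V.map_map]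
  · obtain ⟨h', h''⟩ := Zigzag.arrow_of_mem_Icc' h ⟨hqz, (le_of_not_ge hpz)⟩
    rw [← hs h'' hz₁ (mem₁ hq hqz) hzJ, hst, ← ht h' (mem₂ hp hpz) hz₂ hpJ, V.map_map]
  · exact ht h (mem₂ hp hpz) (mem₂ hq hqz) hpJ

variable (V)

open scoped Classical in
/-- The images of `a ∈ V x` under all arrows starting at `x`, with the value zero elsewhere. -/
noncomputable def push (x : α) (a : V.obj x) (y : α) : V.obj y :=
  if h : Z.Arrow x y then V.map h a else 0

theorem push_of_arrow {x y : α} (h : Z.Arrow x y) (a : V.obj x) : V.push x a y = V.map h a := by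
  simp [push, h]

theorem push_self (x : α) (a : V.obj x) : V.push x a x = a := by
  rw [V.push_of_arrow (Z.refl x), V.map_refl]

theorem isSection_push {T : Set α} {x : α} (a : V.obj x) (hT : ∀ y ∈ T, Z.Arrow x y) :
    V.IsSection univ T (V.push x a) := by
  intro p q h hp hq _
  rw [V.push_of_arrow (hT p hp), V.push_of_arrow (hT q hq), V.map_map]

theorem isSection_zero (J T : Set α) : V.IsSection J T 0 :=
  fun p q h _ _ _ => by simp

/-- The subspace of families that are sections over `T`. -/
def sections (T : Set α) : Submodule k (∀ x, V.obj x) where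
  carrier := {s | V.IsSection univ T s}
  zero_mem' := V.isSection_zero _ _
  add_mem' {s t} hs ht := fun p q h hp hq hJ => by
    simp only [Pi.add_apply, map_add, hs h hp hq hJ, ht h hp hq hJ]
  smul_mem' c s hs := fun p q h hp hq hJ => by
    simp only [Pi.smul_apply, map_smul, hs h hp hq hJ]

/-- The subspace of `V x` of the values at `x` of those sections over `[y, x]` whose value at `y`
lies in `U`. -/
def transport (y x : α) (U : Submodule k (V.obj y)) : Submodule k (V.obj x) :=
  (V.sections (Icc y x) ⊓ U.comap (LinearMap.proj y)).map (LinearMap.proj x)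

variable {V}

theorem mem_transport {y x : α} {U : Submodule k (V.obj y)} {v : V.obj x} :
    v ∈ V.transport y x U ↔ ∃ s, V.IsSection univ (Icc y x) s ∧ s y ∈ U ∧ s x = v := by
  simp only [transport, sections, Submodule.mem_map, Submodule.mem_inf, Submodule.mem_comap,
    LinearMap.proj_apply, and_assoc]
  rfl

theorem mem_transport_self {x : α} {U : Submodule k (V.obj x)} {v : V.obj x} :
    v ∈ V.transport x x U ↔ v ∈ U := by
  rw [mem_transport]
  constructor
  · rintro ⟨s, -, h, rfl⟩
    exact h
  · intro h
    refine ⟨V.push x v, V.isSection_push v ?_, by rwa [push_self], push_self _ _ _⟩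
    intro y hy
    obtain rfl : y = x := le_antisymm hy.2 hy.1
    exact Z.refl _

theorem transport_mono {y x : α} {U U' : Submodule k (V.obj y)} (h : U ≤ U') :
    V.transport y x U ≤ V.transport y x U' := by
  intro v hv
  obtain ⟨s, hs, hU, rfl⟩ := mem_transport.1 hv
  exact mem_transport.2 ⟨s, hs, h hU, rfl⟩

/-- A section on `[y, z]` prolongs along an arrow `z → x` to the right. -/
theorem map_mem_transport {y z x : α} (hyz : y ≤ z) (hzx : z ≤ x) (h : Z.Arrow z x)
    {U : Submodule k (V.obj y)} {a : V.obj z} (ha : a ∈ V.transport y z U) :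
    V.map h a ∈ V.transport y x U := by
  obtain ⟨s, hs, hU, rfl⟩ := mem_transport.1 ha
  have hg := hs.glue (V.isSection_push (T := Icc z x) (s z)
    fun p hp => (Zigzag.arrow_of_mem_Icc h hp).1) (fun p hp => hp.2) (fun p hp => hp.1)
    ⟨hyz, le_rfl⟩ ⟨le_rfl, hzx⟩ (mem_univ _) (push_self _ _ _).symm
  rw [Icc_union_Icc_eq_Icc hyz hzx] at hg
  refine mem_transport.2 ⟨_, hg, by simpa [hyz] using hU, ?_⟩
  split_ifs with hxz
  · obtain rfl : z = x := le_antisymm hzx hxz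
    rw [V.map_refl]
  · exact V.push_of_arrow h _

/-- A section on `[y, z]` prolongs against an arrow `x → z` to the right, once a preimage of its
value at `z` is given. -/
theorem mem_transport_of_map_mem {y z x : α} (hyz : y ≤ z) (hzx : z ≤ x) (h : Z.Arrow x z)
    {U : Submodule k (V.obj y)} {a : V.obj x} (ha : V.map h a ∈ V.transport y z U) :
    a ∈ V.transport y x U := by
  obtain ⟨s, hs, hU, hsz⟩ := mem_transport.1 ha
  have hg := hs.glue (V.isSection_push (T := Icc z x) a
    fun p hp => (Zigzag.arrow_of_mem_Icc' h hp).1) (fun p hp => hp.2) (fun p hp => hp.1)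
    ⟨hyz, le_rfl⟩ ⟨le_rfl, hzx⟩ (mem_univ _) (by rw [V.push_of_arrow h, hsz])
  rw [Icc_union_Icc_eq_Icc hyz hzx] at hg
  refine mem_transport.2 ⟨_, hg, by simpa [hyz] using hU, ?_⟩
  split_ifs with hxz
  · obtain rfl : z = x := le_antisymm hzx hxz
    rw [hsz, V.map_refl]
  · exact V.push_self _ _

theorem transport_top_anti {y' y x : α} (hyy : y' ≤ y) :
    V.transport y' x ⊤ ≤ V.transport y x ⊤ := by
  intro v hv
  obtain ⟨s, hs, -, rfl⟩ := mem_transport.1 hv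
  exact mem_transport.2 ⟨s, hs.mono subset_rfl (Icc_subset_Icc_left hyy), trivial, rfl⟩

/-- A section on `[y, x]` that vanishes at `y` can be prolonged by zero to the left of `y`. -/
theorem exists_section_zero_left {y x : α} (hyx : y ≤ x) {v : V.obj x}
    (hv : v ∈ V.transport y x ⊥) :
    ∃ s, V.IsSection univ (Iic x) s ∧ (∀ p ≤ y, s p = 0) ∧ s x = v := by
  obtain ⟨s, hs, hy, rfl⟩ := mem_transport.1 hv
  rw [Submodule.mem_bot] at hy
  have hg := (V.isSection_zero univ (Iic y)).glue hs subset_rfl (fun p hp => hp.1)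
    (mem_Iic.2 le_rfl) ⟨le_rfl, hyx⟩ (mem_univ _) hy.symm
  rw [Iic_union_Icc_eq_Iic hyx] at hg
  refine ⟨_, hg, fun p hp => if_pos hp, ?_⟩
  split_ifs with hxy
  · obtain rfl : y = x := le_antisymm hyx hxy
    rw [hy]; rfl
  · rfl

theorem transport_bot_mono {y' y x : α} (hyy : y' ≤ y) (hyx : y ≤ x) :
    V.transport y x ⊥ ≤ V.transport y' x ⊥ := by
  intro v hv
  obtain ⟨s, hs, h0, rfl⟩ := exists_section_zero_left hyx hv
  exact mem_transport.2 ⟨s, hs.mono subset_rfl fun p hp => hp.2, by simp [h0 y' hyy], rfl⟩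

theorem transport_bot_le_transport_top {y y' x : α} (hy : y ≤ x) :
    V.transport y x ⊥ ≤ V.transport y' x ⊤ := by
  rcases le_total y y' with h | h
  · exact (transport_mono bot_le).trans (transport_top_anti h)
  · exact (transport_bot_mono h hy).trans (transport_mono bot_le)

/-- Along an arrow from `y'` to a point `y` on its left, sections over `[y', x]` prolong to `y`. -/
theorem transport_top_le_of_arrow {y y' x : α} (h : Z.Arrow y' y) (hyy : y ≤ y') (hx : y' ≤ x) :
    V.transport y' x ⊤ ≤ V.transport y x ⊤ := by
  intro v hv
  obtain ⟨s, hs, -, rfl⟩ := mem_transport.1 hv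
  have hg := (V.isSection_push (T := Icc y y') (s y')
    fun p hp => (Zigzag.arrow_of_mem_Icc' h hp).1).glue hs (fun p hp => hp.2) (fun p hp => hp.1)
    ⟨hyy, le_rfl⟩ ⟨le_rfl, hx⟩ (mem_univ _) (push_self _ _ _)
  rw [Icc_union_Icc_eq_Icc hyy hx] at hg
  refine mem_transport.2 ⟨_, hg, trivial, ?_⟩
  split_ifs with hxy
  · obtain rfl : y' = x := le_antisymm hx hxy
    exact push_self _ _ _
  · rfl

/-- Along an arrow from `y` to a point `y'` on its right, vanishing at `y` implies vanishing at
`y'`. -/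
theorem transport_bot_le_of_arrow {y y' x : α} (h : Z.Arrow y y') (hyy : y ≤ y') (hx : y' ≤ x) :
    V.transport y x ⊥ ≤ V.transport y' x ⊥ := by
  intro v hv
  obtain ⟨s, hs, hy, rfl⟩ := mem_transport.1 hv
  rw [Submodule.mem_bot] at hy
  refine mem_transport.2 ⟨s, hs.mono subset_rfl (Icc_subset_Icc_left hyy), ?_, rfl⟩
  rw [Submodule.mem_bot, ← hs h ⟨le_rfl, hyy.trans hx⟩ ⟨hyy, hx⟩ (mem_univ _), hy, map_zero]

variable (V) in
/-- The subspaces of `V x` of vectors that extend to some `y ≤ x` as a section, or as a section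
that vanishes at `y`. -/
def chainAt (x : α) : Set (Submodule k (V.obj x)) :=
  {N | ∃ y ≤ x, N = V.transport y x ⊥ ∨ N = V.transport y x ⊤}

/-- As `y` moves to the left, the spaces `transport y x ⊥` increase, the spaces `transport y x ⊤`
decrease, and each of the former lies in each of the latter. -/
theorem isChain_chainAt (x : α) : IsChain (· ≤ ·) (V.chainAt x) := by
  rintro _ ⟨y, hy, rfl | rfl⟩ _ ⟨y', hy', rfl | rfl⟩ -
  · exact (le_total y y').symm.imp (fun h => transport_bot_mono h hy)
      fun h => transport_bot_mono h hy'
  · exact Or.inl (transport_bot_le_transport_top hy)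
  · exact Or.inr (transport_bot_le_transport_top hy')
  · exact (le_total y y').imp transport_top_anti transport_top_anti

/-- Duality for sections: a functional on `V x` that kills `transport y x U` extends to a section
of the dual representation over `[y, x]` that annihilates `U` at `y`. One proceeds along a chain of
arrows from `y` to `x`. -/
theorem exists_dual_section {y x : α} (hyx : y ≤ x) {U : Submodule k (V.obj y)}
    {φ : Module.Dual k (V.obj x)} (hφ : V.transport y x U ≤ LinearMap.ker φ) :
    φ ∈ V.dual.transport y x U.dualAnnihilator := by
  have hchain := Z.chain hyx
  clear hyx
  suffices H : y ≤ x ∧ ∀ φ : Module.Dual k (V.obj x), V.transport y x U ≤ LinearMap.ker φ →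
      φ ∈ V.dual.transport y x U.dualAnnihilator from H.2 φ hφ
  clear hφ φ
  induction hchain with
  | refl =>
    refine ⟨le_rfl, fun φ hφ => ?_⟩
    rw [mem_transport_self]
    exact (Submodule.mem_dualAnnihilator φ).2 fun a ha => hφ (mem_transport_self.2 ha)
  | @tail z x _ hzx ih =>
    obtain ⟨hyz, ih⟩ := ih
    obtain ⟨hzx, h | h⟩ := hzx
    · refine ⟨hyz.trans hzx, fun φ hφ => ?_⟩
      refine mem_transport_of_map_mem (V := V.dual) hyz hzx h (ih _ fun a ha => ?_)
      exact hφ (map_mem_transport hyz hzx h ha)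
    · refine ⟨hyz.trans hzx, fun φ hφ => ?_⟩
      set N := V.transport y z U
      -- `φ` kills the kernel of `V x → V z ⧸ N`, so it factors through this map
      have hker : LinearMap.ker (N.mkQ ∘ₗ V.map h) ≤ LinearMap.ker φ := by
        intro a ha
        rw [LinearMap.mem_ker, LinearMap.comp_apply, Submodule.mkQ_apply,
          Submodule.Quotient.mk_eq_zero] at ha
        exact hφ (mem_transport_of_map_mem hyz hzx h ha)
      obtain ⟨g, hg⟩ : ∃ g : V.obj z ⧸ N →ₗ[k] k, g ∘ₗ (N.mkQ ∘ₗ V.map h) = φ := by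
        have : φ ∈ LinearMap.range (N.mkQ ∘ₗ V.map h).dualMap := by
          rw [LinearMap.range_dualMap_eq_dualAnnihilator_ker, Submodule.mem_dualAnnihilator]
          exact fun a ha => hker ha
        exact this
      have := map_mem_transport (V := V.dual) hyz hzx h (ih (g ∘ₗ N.mkQ) fun a ha => by
        simp [(Submodule.Quotient.mk_eq_zero N).2 ha])
      rwa [show V.dual.map h (g ∘ₗ N.mkQ) = φ from by rw [← hg]; rfl] at this
/-! ### Interval summands -/

/-- A section over `T` that vanishes off `J` and takes the value `v` at `x` exists as soon as the
conditions can be met on every finite subset of `T`. -/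
theorem exists_section_of_finset [∀ x, FiniteDimensional k (V.obj x)] {J T : Set α} {x : α}
    {v : V.obj x}
    (h : ∀ P : Finset α, (P : Set α) ⊆ T →
      ∃ s, V.IsSection univ (P : Set α) s ∧ (∀ p ∈ P, p ∉ J → s p = 0) ∧ s x = v) :
    ∃ s, V.IsSection univ T s ∧ (∀ p ∈ T, p ∉ J → s p = 0) ∧ s x = v := by
  let π : ∀ x, (∀ x, V.obj x) →ₗ[k] V.obj x := fun x => LinearMap.proj x
  let C₁ : Set (Module.Dual k (∀ x, V.obj x) × k) :=
    {c | ∃ p ∈ T, ∃ q ∈ T, ∃ (h : Z.Arrow p q) (ξ : Module.Dual k (V.obj q)),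
      c = ((ξ ∘ₗ V.map h) ∘ₗ π p - ξ ∘ₗ π q, 0)}
  let C₂ : Set (Module.Dual k (∀ x, V.obj x) × k) :=
    {c | ∃ p ∈ T, p ∉ J ∧ ∃ ξ : Module.Dual k (V.obj p), c = (ξ ∘ₗ π p, 0)}
  let C₃ : Set (Module.Dual k (∀ x, V.obj x) × k) :=
    {c | ∃ ξ : Module.Dual k (V.obj x), c = (ξ ∘ₗ π x, ξ v)}
  obtain ⟨s, hs⟩ := exists_pi_forall_eq (C₁ ∪ C₂ ∪ C₃) (by
    rintro _ ((⟨p, -, q, -, h, ξ, rfl⟩ | ⟨p, -, -, ξ, rfl⟩) | ⟨ξ, rfl⟩)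
    · exact sub_mem (Submodule.subset_span ⟨p, _, rfl⟩) (Submodule.subset_span ⟨q, _, rfl⟩)
    · exact Submodule.subset_span ⟨p, _, rfl⟩
    · exact Submodule.subset_span ⟨x, _, rfl⟩) (by
    classical
    have key : ∀ c ∈ Submodule.span k (C₁ ∪ C₂ ∪ C₃), ∃ P : Finset α, (P : Set α) ⊆ T ∧
        ∀ s, V.IsSection univ (P : Set α) s → (∀ p ∈ P, p ∉ J → s p = 0) → s x = v →
          c.1 s = c.2 := by
      intro c hc
      induction hc using Submodule.span_induction with
      | mem c hc =>
        rcases hc with ((⟨p, hp, q, hq, h, ξ, rfl⟩ | ⟨p, hp, hpJ, ξ, rfl⟩) | ⟨ξ, rfl⟩)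
        · refine ⟨{p, q}, by simp [insert_subset_iff, hp, hq], fun s hs _ _ => ?_⟩
          have := hs h (by simp) (by simp) (mem_univ _)
          simp [π, this]
        · refine ⟨{p}, by simp [hp], fun s _ hs _ => ?_⟩
          simp [π, hs p (by simp) hpJ]
        · exact ⟨∅, by simp, fun s _ _ hs => by simp [π, hs]⟩
      | zero => exact ⟨∅, by simp, by simp⟩
      | add a b _ _ ha hb =>
        obtain ⟨P, hP, hPs⟩ := ha
        obtain ⟨Q, hQ, hQs⟩ := hb
        refine ⟨P ∪ Q, by simp [hP, hQ], fun s h₁ h₂ h₃ => ?_⟩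
        have h₄ := hPs s (h₁.mono subset_rfl (by simp)) (fun p hp => h₂ p (by simp [hp])) h₃
        have h₅ := hQs s (h₁.mono subset_rfl (by simp)) (fun p hp => h₂ p (by simp [hp])) h₃
        simp [h₄, h₅]
      | smul r a _ ha =>
        obtain ⟨P, hP, hPs⟩ := ha
        exact ⟨P, hP, fun s h₁ h₂ h₃ => by simp [hPs s h₁ h₂ h₃]⟩
    intro h01
    obtain ⟨P, hP, hPs⟩ := key _ h01
    obtain ⟨s, h₁, h₂, h₃⟩ := h P hP
    simpa using hPs s h₁ h₂ h₃)
  have ext : ∀ {y} {a b : V.obj y}, (∀ ξ : Module.Dual k (V.obj y), ξ a = ξ b) → a = b := by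
    intro y a b hab
    rw [← sub_eq_zero, ← Module.forall_dual_apply_eq_zero_iff k]
    intro ξ
    rw [map_sub, hab, sub_self]
  refine ⟨s, fun p q h hp hq _ => ext fun ξ => ?_, fun p hp hpJ => ext fun ξ => ?_,
    ext fun ξ => ?_⟩
  · have := hs _ (Or.inl (Or.inl ⟨p, hp, q, hq, h, ξ, rfl⟩))
    simpa [π, sub_eq_zero] using this
  · have := hs _ (Or.inl (Or.inr ⟨p, hp, hpJ, ξ, rfl⟩))
    simpa [π] using this
  · have := hs _ (Or.inr ⟨ξ, rfl⟩)
    simpa [π] using this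

/-- If `v ∈ V x` extends as a section to every point of `J`, a set of points to the left of `x`,
then it extends to a homomorphism from the interval representation on `J` to `V`, at least to the left
of `x`: either because `v` extends by zero to all points outside `J`, or because no arrow leaves
`J` to the left. -/
theorem exists_section_Iic [∀ x, FiniteDimensional k (V.obj x)] {J : Set α} {x : α} (hx : x ∈ J)
    (hJx : J ⊆ Iic x) {v : V.obj x}
    (hv : ∀ y ∈ J, v ∈ V.transport y x ⊤)
    (hout : (∀ y ≤ x, y ∉ J → v ∈ V.transport y x ⊥) ∨
      ∀ y ≤ x, y ∉ J → ∀ y' ∈ J, ¬ Z.Arrow y' y) :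
    ∃ s, V.IsSection J (Iic x) s ∧ (∀ p, p ∉ J → s p = 0) ∧ s x = v := by
  classical
  obtain ⟨T, hJT, hTx, hT, hTZ⟩ : ∃ T, J ⊆ T ∧ T ⊆ Iic x ∧
      (∀ y ∈ T, y ∉ J → v ∈ V.transport y x ⊥) ∧
      (∀ p ∈ J, ∀ q ≤ x, Z.Arrow p q → q ∈ T) := by
    rcases hout with h | h
    · exact ⟨Iic x, hJx, subset_rfl, h, fun _ _ q hq _ => hq⟩
    · exact ⟨J, subset_rfl, hJx, fun y hy hyJ => absurd hy hyJ, fun p hp q hq hpq => by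
        by_contra hqJ
        exact h q hq hqJ p hp hpq⟩
  obtain ⟨s, hs, hs0, hsx⟩ : ∃ s, V.IsSection univ T s ∧ (∀ p ∈ T, p ∉ J → s p = 0) ∧ s x = v := by
    refine exists_section_of_finset fun P hP => ?_
    by_cases hne : (P.filter (· ∉ J)).Nonempty
    · -- prolong by zero from the last point of `P` outside `J`
      set y := (P.filter (· ∉ J)).max' hne
      have hy : y ∈ P ∧ y ∉ J := by simpa using (P.filter (· ∉ J)).max'_mem hne
      obtain ⟨s, hs, hs0, hsx⟩ :=
        exists_section_zero_left (hTx (hP hy.1)) (hT y (hP hy.1) hy.2)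
      exact ⟨s, hs.mono subset_rfl (hP.trans hTx), fun p hp hpJ =>
        hs0 p (Finset.le_max' _ _ (by simp [hp, hpJ])), hsx⟩
    · have hPJ : ∀ p ∈ P, p ∈ J := by
        intro p hp
        by_contra hpJ
        exact hne ⟨p, by simp [hp, hpJ]⟩
      set y := (insert x P).min' (Finset.insert_nonempty _ _)
      have hy : y ∈ J := by
        have := (insert x P).min'_mem (Finset.insert_nonempty _ _)
        rcases Finset.mem_insert.1 this with h | h
        · rwa [show y = x from h]
        · exact hPJ _ h
      obtain ⟨s, hs, -, hsx⟩ := mem_transport.1 (hv y hy)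
      exact ⟨s, hs.mono subset_rfl fun p hp =>
        ⟨Finset.min'_le _ _ (Finset.mem_insert_of_mem hp), hTx (hP hp)⟩,
        fun p hp hpJ => absurd (hPJ p hp) hpJ, hsx⟩
  refine ⟨fun p => if p ∈ J then s p else 0, fun p q h hp hq hpJ => ?_,
    fun p hp => if_neg hp, by simp [hx, hsx]⟩
  have hqT := hTZ p hpJ q hq h
  simp only [hpJ, if_true, hs h (hJT hpJ) hqT (mem_univ _)]
  split_ifs with hqJ
  · rfl
  · exact hs0 q hqT hqJ

/-- The interval `J` consists of the points `y ≤ x` to which `v` extends as a section but not as a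
section vanishing at `y`. At its left end either `v` extends by zero, and no arrow enters `J`, or
`v` does not extend, and no arrow leaves `J`. In the dual representation the two cases are
exchanged. -/
theorem exists_half_summand [∀ x, FiniteDimensional k (V.obj x)] {x : α} {v : V.obj x}
    {φ : Module.Dual k (V.obj x)} (hφv : φ v = 1)
    (hφ : ∀ N ∈ V.chainAt x, v ∉ N → N ≤ LinearMap.ker φ) :
    ∃ (J : Set α) (s : ∀ p, V.obj p) (ψ : ∀ p, Module.Dual k (V.obj p)),
      x ∈ J ∧ J ⊆ Iic x ∧ (∀ y ∈ J, Icc y x ⊆ J) ∧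
      V.IsSection J (Iic x) s ∧ (∀ p, p ∉ J → s p = 0) ∧ s x = v ∧
      V.dual.IsSection J (Iic x) ψ ∧ (∀ p, p ∉ J → ψ p = 0) ∧ ψ x = φ := by
  have hv0 : v ≠ 0 := by rintro rfl; simp at hφv
  set J : Set α := {y | y ≤ x ∧ v ∉ V.transport y x ⊥ ∧ v ∈ V.transport y x ⊤} with hJ_def
  have hxJ : x ∈ J := by
    refine ⟨le_rfl, ?_, ?_⟩
    · rw [mem_transport_self]; simpa using hv0
    · rw [mem_transport_self]; trivial
  have hJx : J ⊆ Iic x := fun y hy => hy.1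
  have hJ : ∀ y ∈ J, Icc y x ⊆ J := fun y hy z hz =>
    ⟨hz.2, fun h => hy.2.1 (transport_bot_mono hz.1 hz.2 h), transport_top_anti hz.1 hy.2.2⟩
  have hφtop : ∀ y ≤ x, v ∉ V.transport y x ⊥ → φ ∈ V.dual.transport y x ⊤ := by
    intro y hy hvy
    have := exists_dual_section hy (hφ _ ⟨y, hy, Or.inl rfl⟩ hvy)
    exact transport_mono le_top this
  have hφbot : ∀ y ≤ x, v ∉ V.transport y x ⊤ → φ ∈ V.dual.transport y x ⊥ := by
    intro y hy hvy
    have := exists_dual_section hy (hφ _ ⟨y, hy, Or.inr rfl⟩ hvy)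
    rwa [Submodule.dualAnnihilator_top] at this
  have hle : ∀ {p q}, q ≤ x → q ∉ J → p ∈ J → q ≤ p := by
    intro p q hq hqJ hp
    by_contra! h
    exact hqJ (hJ p hp ⟨h.le, hq⟩)
  have hfd : ∀ x, FiniteDimensional k (V.dual.obj x) := fun x =>
    inferInstanceAs (FiniteDimensional k (Module.Dual k (V.obj x)))
  have hV : (∀ y ≤ x, y ∉ J → v ∈ V.transport y x ⊥) ∨
      ∀ y ≤ x, y ∉ J → ∀ y' ∈ J, ¬ Z.Arrow y' y := by
    by_cases h : ∀ y ≤ x, y ∉ J → v ∈ V.transport y x ⊥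
    · exact Or.inl h
    · push Not at h
      obtain ⟨y₀, hy₀, hy₀J, hvy₀⟩ := h
      have hvy₀' : v ∉ V.transport y₀ x ⊤ := fun h => hy₀J ⟨hy₀, hvy₀, h⟩
      refine Or.inr fun y hy hyJ y' hy' h => ?_
      have h1 := transport_top_le_of_arrow h (hle hy hyJ hy') hy'.1 hy'.2.2
      have h2 : v ∈ V.transport y x ⊥ := by
        by_contra h2
        exact hyJ ⟨hy, h2, h1⟩
      exact hvy₀' (transport_bot_le_transport_top hy h2)
  have hdual : (∀ y ≤ x, y ∉ J → φ ∈ V.dual.transport y x ⊥) ∨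
      ∀ y ≤ x, y ∉ J → ∀ y' ∈ J, ¬ Z.op.Arrow y' y := by
    by_cases h : ∀ y ≤ x, y ∉ J → v ∉ V.transport y x ⊤
    · exact Or.inl fun y hy hyJ => hφbot y hy (h y hy hyJ)
    · push Not at h
      obtain ⟨y₀, hy₀, hy₀J, hvy₀⟩ := h
      have hvy₀' : v ∈ V.transport y₀ x ⊥ := by
        by_contra h
        exact hy₀J ⟨hy₀, h, hvy₀⟩
      refine Or.inr fun y hy hyJ y' hy' h => ?_
      have h1 : v ∈ V.transport y x ⊤ := transport_bot_le_transport_top hy₀ hvy₀'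
      have h2 : v ∈ V.transport y x ⊥ := by
        by_contra h2
        exact hyJ ⟨hy, h2, h1⟩
      exact hy'.2.1 (transport_bot_le_of_arrow (show Z.Arrow y y' from h) (hle hy hyJ hy') hy'.1 h2)
  obtain ⟨s, hs, hs0, hsx⟩ := exists_section_Iic hxJ hJx (fun y hy => hy.2.2) hV
  obtain ⟨ψ, hψ, hψ0, hψx⟩ := exists_section_Iic (V := V.dual) hxJ hJx
    (fun y hy => hφtop y hy.1 hy.2.1) hdual
  exact ⟨J, s, ψ, hxJ, hJx, hJ, hs, hs0, hsx, hψ, hψ0, hψx⟩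

/-- A section to the left of `z` and one to the right of `z` that agree at `z` give a global one. -/
theorem IsSection.glue_univ {J₁ J₂ : Set α} {s t : ∀ x, V.obj x} {z : α}
    (hs : V.IsSection J₁ (Iic z) s) (ht : V.IsSection J₂ (Ici z) t)
    (h₁ : J₁ ⊆ Iic z) (h₂ : J₂ ⊆ Ici z) (hz₁ : z ∈ J₁) (hz₂ : z ∈ J₂) (hst : s z = t z) :
    V.IsSection (J₁ ∪ J₂) univ (fun p => if p ≤ z then s p else t p) := by
  have hs' : V.IsSection (J₁ ∪ J₂) (Iic z) s := by
    rintro p q h hp hq (hpJ | hpJ)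
    · exact hs h hp hq hpJ
    · obtain rfl : p = z := le_antisymm hp (h₂ hpJ)
      exact hs h hp hq hz₁
  have ht' : V.IsSection (J₁ ∪ J₂) (Ici z) t := by
    rintro p q h hp hq (hpJ | hpJ)
    · obtain rfl : p = z := le_antisymm (h₁ hpJ) hp
      exact ht h hp hq hz₂
    · exact ht h hp hq hpJ
  have := hs'.glue ht' subset_rfl subset_rfl (mem_Iic.2 le_rfl) (mem_Ici.2 le_rfl) (Or.inl hz₁) hst
  rwa [Iic_union_Ici] at this

/-- Every point `x` with `V x ≠ 0` lies in an interval `I` whose interval representation is a direct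
summand of `V`: the family `s` is the inclusion and the family `ψ` is the retraction. -/
theorem exists_interval_summand [∀ x, FiniteDimensional k (V.obj x)] (x : α)
    [Nontrivial (V.obj x)] :
    ∃ (I : Set α) (s : ∀ p, V.obj p) (ψ : ∀ p, Module.Dual k (V.obj p)),
      x ∈ I ∧ I.OrdConnected ∧ V.IsSection I univ s ∧ (∀ p, p ∉ I → s p = 0) ∧
      V.dual.IsSection I univ ψ ∧ (∀ p, p ∉ I → ψ p = 0) ∧ ∀ p ∈ I, ψ p (s p) = 1 := by
  have hfd : ∀ x, FiniteDimensional k (V.mirror.obj x) := fun x =>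
    inferInstanceAs (FiniteDimensional k (V.obj (OrderDual.ofDual x)))
  obtain ⟨v, φ, hφv, hφ⟩ := exists_dual_eq_one_of_isChain (V.isChain_chainAt x)
    (V.mirror.isChain_chainAt (OrderDual.toDual x))
  obtain ⟨J₁, s₁, ψ₁, hx₁, hJx₁, hJ₁, hs₁, hs0₁, hsx₁, hψ₁, hψ0₁, hψx₁⟩ :=
    V.exists_half_summand hφv fun N hN => hφ N (Or.inl hN)
  obtain ⟨J₂, s₂, ψ₂, hx₂, hJx₂, hJ₂, hs₂, hs0₂, hsx₂, hψ₂, hψ0₂, hψx₂⟩ :=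
    V.mirror.exists_half_summand (x := OrderDual.toDual x) hφv fun N hN => hφ N (Or.inr hN)
  have hs₂' : V.IsSection (OrderDual.toDual ⁻¹' J₂) (Ici x) s₂ := fun p q h hp hq hpJ =>
    hs₂ (p := OrderDual.toDual p) (q := OrderDual.toDual q) h hp hq hpJ
  have hψ₂' : V.dual.IsSection (OrderDual.toDual ⁻¹' J₂) (Ici x) ψ₂ := fun p q h hp hq hpJ =>
    hψ₂ (p := OrderDual.toDual p) (q := OrderDual.toDual q) h hp hq hpJ
  have hI : (J₁ ∪ (OrderDual.toDual ⁻¹' J₂ : Set α)).OrdConnected := by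
    refine ⟨fun p hp q hq z hz => ?_⟩
    rcases le_total z x with hzx | hzx
    · rcases hp with hp | hp
      · exact Or.inl (hJ₁ p hp ⟨hz.1, hzx⟩)
      · have : x ≤ p := hJx₂ hp
        obtain rfl : z = x := le_antisymm hzx (this.trans hz.1)
        exact Or.inl hx₁
    · rcases hq with hq | hq
      · have : q ≤ x := hJx₁ hq
        obtain rfl : z = x := le_antisymm (hz.2.trans this) hzx
        exact Or.inl hx₁
      · exact Or.inr (hJ₂ _ hq ⟨hz.2, hzx⟩)
  have hs := hs₁.glue_univ hs₂' hJx₁ hJx₂ hx₁ hx₂ (hsx₁.trans hsx₂.symm)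
  have hψ := IsSection.glue_univ (V := V.dual) hψ₁ hψ₂' hJx₁ hJx₂ hx₁ hx₂ (hψx₁.trans hψx₂.symm)
  refine ⟨_, _, _, Or.inl hx₁, hI, hs, fun p hp => ?_, hψ, fun p hp => ?_, fun p hp => ?_⟩
  · by_cases hpx : p ≤ x
    · exact (if_pos hpx).trans (hs0₁ p fun h => hp (Or.inl h))
    · exact (if_neg hpx).trans (hs0₂ p fun h => hp (Or.inr h))
  · by_cases hpx : p ≤ x
    · exact (if_pos hpx).trans (hψ0₁ p fun h => hp (Or.inl h))
    · exact (if_neg hpx).trans (hψ0₂ p fun h => hp (Or.inr h))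
  · set s : ∀ p, V.obj p := fun p => if p ≤ x then s₁ p else s₂ p
    set ψ : ∀ p, Module.Dual k (V.obj p) := fun p => if p ≤ x then ψ₁ p else ψ₂ p
    rw [Z.eq_of_arrow_eq hI (fun p => ψ p (s p)) ?_ hp (Or.inl hx₁ : x ∈ _)]
    · simp [s, ψ, hsx₁, hψx₁, hφv]
    · intro p hp q hq h
      rw [← hs h (mem_univ _) (mem_univ _) hp,
        ← hψ (p := q) (q := p) h (mem_univ _) (mem_univ _) hq]
      rfl
/-! ### Decomposition by Zorn's lemma -/

variable (V) in
/-- A family of vectors generating a copy of an interval representation: its support is an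
interval `I`, it is compatible with the arrows in `I`, and it is sent to zero by the arrows
leaving `I`. -/
structure IsIntervalSection (s : ∀ x, V.obj x) : Prop where
  nonempty : {x | s x ≠ 0}.Nonempty
  ordConnected : {x | s x ≠ 0}.OrdConnected
  isSection : V.IsSection {x | s x ≠ 0} univ s

variable (V) in
/-- The set `F` generates a direct sum of interval representations that is complementary to the
subrepresentation `C`: at each point `x` the nonzero values of the members of `F` form a basis of
`V x` modulo `C x`. -/
structure IsPartialDecomposition (F : Set (∀ x, V.obj x)) (C : ∀ x, Submodule k (V.obj x)) :
    Prop where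
  isIntervalSection : ∀ s ∈ F, V.IsIntervalSection s
  map_mem : ∀ {x y : α} (h : Z.Arrow x y), ∀ a ∈ C x, V.map h a ∈ C y
  linearIndepOn : ∀ x, LinearIndepOn k (fun s => (C x).mkQ (s x)) {s ∈ F | s x ≠ 0}
  span_sup : ∀ x, Submodule.span k ((fun s => s x) '' {s ∈ F | s x ≠ 0}) ⊔ C x = ⊤

theorem isPartialDecomposition_empty : V.IsPartialDecomposition ∅ fun _ => ⊤ where
  isIntervalSection := by simp
  map_mem := by simp
  linearIndepOn x := by simp
  span_sup x := by simp

/-- A nonzero complement splits off a further interval summand. -/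
theorem IsPartialDecomposition.exists_lt [∀ x, FiniteDimensional k (V.obj x)]
    {F : Set (∀ x, V.obj x)} {C : ∀ x, Submodule k (V.obj x)} (h : V.IsPartialDecomposition F C)
    {x : α} (hx : C x ≠ ⊥) :
    ∃ F' C', V.IsPartialDecomposition F' C' ∧ F ⊆ F' ∧ C' < C := by
  let W := V.sub C h.map_mem
  have hfd : ∀ x, FiniteDimensional k (W.obj x) := fun x =>
    inferInstanceAs (FiniteDimensional k (C x))
  have hnt : Nontrivial (W.obj x) := (Submodule.nontrivial_iff_ne_bot).2 hx
  obtain ⟨I, s, ψ, hxI, hI, hs, hs0, hψ, hψ0, hψs⟩ := W.exists_interval_summand x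
  let t : ∀ p, V.obj p := fun p => (s p : C p).1
  let C' : ∀ p, Submodule k (V.obj p) := fun p =>
    (LinearMap.ker (ψ p : C p →ₗ[k] k)).map (C p).subtype
  have hC' : ∀ p, C' p ≤ C p := fun p => Submodule.map_subtype_le _ _
  have mem_C' : ∀ {p} (a : C p), (a : V.obj p) ∈ C' p ↔ ψ p a = 0 := by
    intro p a
    constructor
    · rintro ⟨b, hb, hba⟩
      rwa [← Subtype.ext hba]
    · intro ha
      exact ⟨a, ha, rfl⟩
  have htC : ∀ p, t p ∈ C p := fun p => (s p : C p).2
  have ht : ∀ p, t p ≠ 0 ↔ p ∈ I := by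
    intro p
    constructor
    · intro hp
      by_contra hpI
      exact hp (congrArg Subtype.val (hs0 p hpI))
    · intro hp hp0
      have h0 : s p = 0 := Subtype.ext hp0
      have h1 := hψs p hp
      rw [h0, map_zero] at h1
      exact zero_ne_one h1
  have htsupp : {p | t p ≠ 0} = I := Set.ext ht
  have htC' : ∀ p ∈ I, t p ∉ C' p := by
    intro p hp hmem
    have h1 := hψs p hp
    rw [(mem_C' (s p)).1 hmem] at h1
    exact zero_ne_one h1
  have hCout : ∀ p, p ∉ I → C' p = C p := by
    intro p hp
    refine le_antisymm (hC' p) fun a ha => ?_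
    have : ψ p (⟨a, ha⟩ : C p) = 0 := by rw [hψ0 p hp]; rfl
    exact (mem_C' ⟨a, ha⟩).2 this
  have hsupp : ∀ p, p ∈ I → {u ∈ insert t F | u p ≠ 0} = insert t {u ∈ F | u p ≠ 0} := by
    intro p hp
    ext u
    simp only [mem_ofPred_eq, mem_insert_iff]
    constructor
    · rintro ⟨rfl | h, h'⟩
      · exact Or.inl rfl
      · exact Or.inr ⟨h, h'⟩
    · rintro (rfl | ⟨h, h'⟩)
      · exact ⟨Or.inl rfl, (ht p).2 hp⟩
      · exact ⟨Or.inr h, h'⟩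
  have hsupp' : ∀ p, p ∉ I → {u ∈ insert t F | u p ≠ 0} = {u ∈ F | u p ≠ 0} := by
    intro p hp
    ext u
    simp only [mem_ofPred_eq, mem_insert_iff]
    constructor
    · rintro ⟨rfl | h, h'⟩
      · exact absurd ((ht p).1 h') hp
      · exact ⟨h, h'⟩
    · rintro ⟨h, h'⟩
      exact ⟨Or.inr h, h'⟩
  refine ⟨insert t F, C', ⟨?_, ?_, ?_, ?_⟩, subset_insert _ _, lt_of_le_of_ne hC' ?_⟩
  · rintro u (rfl | hu)
    · refine ⟨⟨x, (ht x).2 hxI⟩, htsupp ▸ hI, ?_⟩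
      rw [htsupp]
      exact fun p q hpq hp hq hpI => congrArg Subtype.val (hs hpq hp hq hpI)
    · exact h.isIntervalSection u hu
  · intro p q hpq a ha
    lift a to C p using hC' p ha
    have ha' : ψ p a = 0 := (mem_C' a).1 ha
    refine (mem_C' ⟨V.map hpq a, h.map_mem hpq a a.2⟩).2 ?_
    by_cases hq : q ∈ I
    · have := hψ (p := q) (q := p) hpq (mem_univ _) (mem_univ _) hq
      exact (DFunLike.congr_fun this a).trans ha'
    · rw [hψ0 q hq]; rfl
  · intro p
    by_cases hp : p ∈ I
    · rw [hsupp p hp]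
      have hcomp : (fun u : ∀ x, V.obj x => (C p).mkQ (u p)) =
          Submodule.factor (hC' p) ∘ fun u => (C' p).mkQ (u p) := by
        ext u; simp
      have hF := h.linearIndepOn p
      rw [hcomp] at hF
      have hF' : LinearIndepOn k (fun u : ∀ x, V.obj x => (C' p).mkQ (u p)) {u ∈ F | u p ≠ 0} :=
        LinearIndependent.of_comp _ hF
      refine hF'.insert fun hmem => htC' p hp ?_
      have hdisj := Submodule.range_ker_disjoint hF
      have : (C' p).mkQ (t p) = 0 := by
        refine Submodule.disjoint_def.1 hdisj _ ?_ ?_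
        · rwa [image_eq_range] at hmem
        · rw [LinearMap.mem_ker]
          simpa using htC p
      simpa using this
    · rw [hsupp' p hp, hCout p hp]
      exact h.linearIndepOn p
  · intro p
    by_cases hp : p ∈ I
    · rw [hsupp p hp, eq_top_iff, ← h.span_sup p]
      refine sup_le ((Submodule.span_mono (image_mono (subset_insert _ _))).trans le_sup_left)
        fun a ha => ?_
      lift a to C p using ha
      have h1 : (a : V.obj p) - ψ p a • t p ∈ C' p := by
        let b : W.obj p := a
        have h0 : ψ p (b - ψ p b • s p) = 0 := by
          rw [map_sub, map_smul, hψs p hp, smul_eq_mul, mul_one, sub_self]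
        exact (mem_C' _).2 h0
      rw [← sub_add_cancel (a : V.obj p) (ψ p a • t p)]
      exact add_mem (Submodule.mem_sup_right h1) (Submodule.mem_sup_left
        (Submodule.smul_mem _ _ (Submodule.subset_span ⟨t, mem_insert _ _, rfl⟩)))
    · rw [hsupp' p hp, hCout p hp]
      exact h.span_sup p
  · intro heq
    exact htC' x hxI (heq ▸ htC x)

/-- A chain of partial decompositions, with `F` increasing and `C` decreasing, is bounded by the one
formed by the union of the `F` and the intersection of the `C`, since at each point both are
eventually constant by finite-dimensionality. -/
theorem exists_isPartialDecomposition_of_isChain [∀ x, FiniteDimensional k (V.obj x)]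
    {c : Set (Set (∀ x, V.obj x) × (∀ x, Submodule k (V.obj x))ᵒᵈ)} (hc : IsChain (· ≤ ·) c)
    (hne : c.Nonempty)
    (h : ∀ d ∈ c, V.IsPartialDecomposition d.1 (OrderDual.ofDual d.2)) :
    ∃ F C, V.IsPartialDecomposition F C ∧ ∀ d ∈ c, d.1 ⊆ F ∧ C ≤ OrderDual.ofDual d.2 := by
  let F : Set (∀ x, V.obj x) := ⋃ d ∈ c, d.1
  let C : ∀ x, Submodule k (V.obj x) := fun x =>
    ⨅ (d : Set (∀ x, V.obj x) × (∀ x, Submodule k (V.obj x))ᵒᵈ) (_ : d ∈ c), OrderDual.ofDual d.2 x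
  have key : ∀ x, ∃ d : Set (∀ x, V.obj x) × (∀ x, Submodule k (V.obj x))ᵒᵈ,
      d ∈ c ∧ OrderDual.ofDual d.2 x = C x ∧ {s ∈ F | s x ≠ 0} = {s ∈ d.1 | s x ≠ 0} := by
    intro x
    obtain ⟨_, ⟨d₀, hd₀, rfl⟩, hmin⟩ := WellFounded.has_min
      (wellFounded_lt (α := Submodule k (V.obj x)))
      ((fun d : Set (∀ x, V.obj x) × (∀ x, Submodule k (V.obj x))ᵒᵈ =>
        OrderDual.ofDual d.2 x) '' c) (hne.image _)
    have hd : ∀ d ∈ c, OrderDual.ofDual d₀.2 x ≤ OrderDual.ofDual d.2 x ∧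
        {s ∈ d.1 | s x ≠ 0} ⊆ {s ∈ d₀.1 | s x ≠ 0} := by
      intro d hd
      rcases hc.total hd hd₀ with hle | hle
      · exact ⟨hle.2 x, fun s hs => ⟨hle.1 hs.1, hs.2⟩⟩
      · have hle' : OrderDual.ofDual d.2 x ≤ OrderDual.ofDual d₀.2 x := hle.2 x
        have heq : OrderDual.ofDual d.2 x = OrderDual.ofDual d₀.2 x := by
          by_contra hne
          exact hmin _ ⟨d, hd, rfl⟩ (lt_of_le_of_ne hle' hne)
        refine ⟨heq.ge, fun s hs => ?_⟩
        by_contra hs₀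
        -- the values of `d₀.1` already span `V x` modulo `d₀.2 x`, so `s x` depends on them
        have hind := (h d hd).linearIndepOn x
        rw [heq] at hind
        have hnot := (linearIndepOn_insert hs₀).1 (hind.mono (insert_subset hs
          (fun u hu => ⟨hle.1 hu.1, hu.2⟩)))
        refine hnot.2 ?_
        have hspan := congrArg (Submodule.map (OrderDual.ofDual d₀.2 x).mkQ)
          ((h d₀ hd₀).span_sup x)
        rw [Submodule.map_sup, Submodule.map_top, Submodule.range_mkQ, Submodule.mkQ_map_self,
          sup_bot_eq, Submodule.map_span, image_image] at hspan
        rw [hspan]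
        trivial
    refine ⟨d₀, hd₀, le_antisymm (le_iInf₂ fun d hd' => (hd d hd').1) (iInf₂_le d₀ hd₀), ?_⟩
    ext s
    simp only [F, mem_ofPred_eq, mem_iUnion]
    constructor
    · rintro ⟨⟨d, hd', hs⟩, hsx⟩
      exact (hd d hd').2 ⟨hs, hsx⟩
    · rintro ⟨hs, hsx⟩
      exact ⟨⟨d₀, hd₀, hs⟩, hsx⟩
  refine ⟨F, C, ⟨?_, ?_, ?_, ?_⟩, fun d hd => ⟨subset_biUnion_of_mem (u := fun d => d.1) hd,
    fun x => iInf₂_le d hd⟩⟩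
  · intro s hs
    obtain ⟨d, hd, hs⟩ := mem_iUnion₂.1 hs
    exact (h d hd).isIntervalSection s hs
  · intro x y hxy a ha
    simp only [C, Submodule.mem_iInf] at ha ⊢
    exact fun d hd => (h d hd).map_mem hxy a (ha d hd)
  · intro x
    obtain ⟨d, hd, hC, hF⟩ := key x
    rw [hF, ← hC]
    exact (h d hd).linearIndepOn x
  · intro x
    obtain ⟨d, hd, hC, hF⟩ := key x
    rw [hF, ← hC]
    exact (h d hd).span_sup x

variable (V) in
/-- A pointwise finite-dimensional representation has a set of interval sections whose nonzero
values at each point form a basis. -/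
theorem exists_interval_basis [∀ x, FiniteDimensional k (V.obj x)] :
    ∃ F : Set (∀ x, V.obj x), (∀ s ∈ F, V.IsIntervalSection s) ∧
      ∀ x, LinearIndepOn k (fun s => s x) {s ∈ F | s x ≠ 0} ∧
        Submodule.span k ((fun s => s x) '' {s ∈ F | s x ≠ 0}) = ⊤ := by
  obtain ⟨⟨F, C⟩, -, hmax⟩ := zorn_le_nonempty₀
    {d : Set (∀ x, V.obj x) × (∀ x, Submodule k (V.obj x))ᵒᵈ |
      V.IsPartialDecomposition d.1 (OrderDual.ofDual d.2)} (by
    intro c hcs hc d hd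
    obtain ⟨F, C, hFC, hle⟩ := exists_isPartialDecomposition_of_isChain hc ⟨d, hd⟩ hcs
    exact ⟨(F, OrderDual.toDual C), hFC, fun d hd => ⟨(hle d hd).1, (hle d hd).2⟩⟩)
    (∅, OrderDual.toDual fun _ => ⊤) isPartialDecomposition_empty
  have hFC : V.IsPartialDecomposition F (OrderDual.ofDual C) := hmax.prop
  have hC : ∀ x, OrderDual.ofDual C x = ⊥ := by
    intro x
    by_contra hx
    obtain ⟨F', C', h', hF, hC⟩ := hFC.exists_lt hx
    have := hmax.le_of_ge (y := (F', OrderDual.toDual C')) h' ⟨hF, hC.le⟩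
    exact hC.not_ge this.2
  refine ⟨F, hFC.isIntervalSection, fun x => ⟨?_, ?_⟩⟩
  · exact LinearIndependent.of_comp (Submodule.mkQ _) (hFC.linearIndepOn x)
  · simpa [hC x] using hFC.span_sup x

end ZigzagRep

/-! ### Continuous quivers of type `A` as zigzags -/

namespace ContinuousQuiver

variable (A : ContinuousQuiver)

theorem Segment.of_mem_Icc {A : ContinuousQuiver} {n : ℤ} {x y z : ℝ} (hx : A.Segment n x)
    (hz : A.Segment n z) (hy : y ∈ Icc x z) : A.Segment n y := by
  obtain ⟨h, h', h₁, -⟩ := hx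
  obtain ⟨_, _, -, h₂⟩ := hz
  exact ⟨h, h', h₁.trans (EReal.coe_le_coe_iff.2 hy.1), (EReal.coe_le_coe_iff.2 hy.2).trans h₂⟩

theorem le_or_le_of_segment {n : ℤ} {x y : ℝ} (hx : A.Segment n x) (hy : A.Segment n y) :
    A.le y x ∨ A.le x y := by
  rcases le_total x y with h | h <;> rcases Int.even_or_odd n with hn | hn
  · exact Or.inr ⟨n, hx, hy, Or.inl ⟨hn, h⟩⟩
  · exact Or.inl ⟨n, hy, hx, Or.inr ⟨hn, h⟩⟩
  · exact Or.inl ⟨n, hy, hx, Or.inl ⟨hn, h⟩⟩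
  · exact Or.inr ⟨n, hx, hy, Or.inr ⟨hn, h⟩⟩

theorem le_of_mem_uIcc {x y z : ℝ} (h : A.le z x) (hy : y ∈ uIcc x z) :
    A.le y x ∧ A.le z y := by
  obtain ⟨n, hz, hx, h | h⟩ := h
  · rw [uIcc_of_ge h.2] at hy
    have hyn := hz.of_mem_Icc hx hy
    exact ⟨⟨n, hyn, hx, Or.inl ⟨h.1, hy.2⟩⟩, ⟨n, hz, hyn, Or.inl ⟨h.1, hy.1⟩⟩⟩
  · rw [uIcc_of_le h.2] at hy
    have hyn := hx.of_mem_Icc hz hy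
    exact ⟨⟨n, hyn, hx, Or.inr ⟨h.1, hy.1⟩⟩, ⟨n, hz, hyn, Or.inr ⟨h.1, hy.2⟩⟩⟩

/-- The common endpoint of two consecutive segments is a real number, provided that the right one
contains a real number. -/
theorem exists_mem_segment_of_succ {n : ℤ} {y : ℝ} (hn : ExtInt.ofInt n ∈ A.N)
    (hy : A.Segment (n + 1) y) : ∃ r : ℝ, r ≤ y ∧ A.Segment n r ∧ A.Segment (n + 1) r := by
  obtain ⟨h₁, h₂, hy₁, hy₂⟩ := hy
  have hlt : (A.s ⟨_, hn⟩ : EReal) < A.s ⟨_, h₁⟩ := by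
    rw [s_lt_s, ofInt_lt_ofInt]; exact Int.lt_succ n
  obtain ⟨r, hr⟩ : ∃ r : ℝ, (r : EReal) = A.s ⟨_, h₁⟩ :=
    ⟨(A.s ⟨_, h₁⟩ : EReal).toReal,
      EReal.coe_toReal (hy₁.trans_lt (EReal.coe_lt_top y)).ne (bot_le.trans_lt hlt).ne'⟩
  refine ⟨r, ?_, ⟨hn, h₁, ?_, hr.le⟩, ⟨h₁, h₂, hr.ge, ?_⟩⟩
  · rw [← EReal.coe_le_coe_iff, hr]; exact hy₁
  · rw [hr]; exact hlt.le
  · rw [hr]; exact hy₁.trans hy₂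

/-- Walk from `x` to `y` through the sinks and sources between them. -/
theorem reflTransGen_of_le {x y : ℝ} (hxy : x ≤ y) :
    Relation.ReflTransGen (fun a b => a ≤ b ∧ (A.le b a ∨ A.le a b)) x y := by
  obtain ⟨m, hm⟩ := A.exists_segment x
  obtain ⟨n, hn⟩ := A.exists_segment y
  rcases le_or_gt m n with hmn | hmn
  · induction n, hmn using Int.leInduction generalizing y with
    | base => exact .single ⟨hxy, A.le_or_le_of_segment hm hn⟩
    | succ n hmn ih =>
      have hN : ExtInt.ofInt n ∈ A.N :=
        A.convex.out hm.1 hn.1 ⟨ofInt_le_ofInt.2 hmn, ofInt_le_ofInt.2 (by omega)⟩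
      obtain ⟨r, hry, hr, hr'⟩ := A.exists_mem_segment_of_succ hN hn
      rcases le_total x r with hxr | hrx
      · exact (ih hxr hr).tail ⟨hry, A.le_or_le_of_segment hr' hn⟩
      · exact .single ⟨hxy, A.le_or_le_of_segment (hr'.of_mem_Icc hn ⟨hrx, hxy⟩) hn⟩
  · obtain ⟨h, _, hx, _⟩ := hm
    obtain ⟨_, h', _, hy⟩ := hn
    have hs : (A.s ⟨_, h'⟩ : EReal) ≤ A.s ⟨_, h⟩ := by
      rw [s_le_s, ofInt_le_ofInt]; exact hmn
    obtain rfl : x = y := le_antisymm hxy (EReal.coe_le_coe_iff.1 (hy.trans (hs.trans hx)))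
    exact .refl

/-- The orientation of the real line given by a continuous quiver: an arrow `x → y` for `y ⪯ x`. -/
def zigzag : Zigzag ℝ where
  Arrow x y := A.le y x
  refl := A.le_refl
  trans h h' := A.le_trans h' h
  of_mem_uIcc := A.le_of_mem_uIcc
  chain := A.reflTransGen_of_le

end ContinuousQuiver

namespace QuiverRep

variable {k : Type u} [Field k] {A : ContinuousQuiver}

/-- A representation of a continuous quiver as a representation of the oriented real line. -/
abbrev toZigzagRep (V : QuiverRep.{u, v} k A) : ZigzagRep.{u, v, 0} k A.zigzag where
  obj := V.obj
  map h := V.map h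
  map_refl {x} _ a := LinearMap.congr_fun (V.map_refl x) a
  map_map h h' a := LinearMap.congr_fun (V.map_comp h h') a

/-! ### Interval representations -/

theorem subsingleton_or_of_equiv_prod {N : Submodule k k} {M₁ : Type v} {M₂ : Type w}
    [AddCommGroup M₁] [Module k M₁] [AddCommGroup M₂] [Module k M₂] (e : N ≃ₗ[k] M₁ × M₂) :
    Subsingleton M₁ ∨ Subsingleton M₂ := by
  by_contra! h
  obtain ⟨h₁, h₂⟩ := h
  obtain ⟨a, ha⟩ := exists_ne (0 : M₁)
  obtain ⟨b, hb⟩ := exists_ne (0 : M₂)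
  have h : ((e.symm (a, 0) : N) : k) • e.symm (0, b) = ((e.symm (0, b) : N) : k) • e.symm (a, 0) :=
    Subtype.ext (mul_comm _ _)
  have h' := congrArg (fun c => (e c).2) h
  simp only [map_smul, LinearEquiv.apply_symm_apply, Prod.smul_snd, smul_zero, smul_eq_zero, hb,
    or_false, ZeroMemClass.coe_eq_zero, LinearEquiv.map_eq_zero_iff, Prod.mk_eq_zero, and_true]
    at h'
  exact ha h'

/-- At one point of `I` one of the two summands vanishes, by dimension; it then vanishes on all of
`I`, since the maps of both summands are bijective along the arrows in `I`. -/
theorem isIndecomposable_interval {I : Set ℝ} (hI : I.OrdConnected) (hne : I.Nonempty) :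
    (interval k A I hI).IsIndecomposable := by
  obtain ⟨x₀, hx₀⟩ := hne
  have hout : ∀ x ∉ I, Subsingleton ((interval k A I hI).obj x) := fun x hx =>
    ⟨fun a b => Subtype.ext
      ((intervalObj_eq_zero k hx a).trans (intervalObj_eq_zero k hx b).symm)⟩
  have hbij : ∀ x ∈ I, ∀ y ∈ I, ∀ h : A.le y x,
      Function.Bijective ((interval k A I hI).map h) := by
    intro x hx y hy h
    have hval : ∀ a : intervalObj k I x, (intervalMap k I x y a : k) = a := fun a => by
      rw [coe_intervalMap, if_pos ⟨hx, hy⟩]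
    constructor
    · intro a b hab
      have := congrArg Subtype.val hab
      exact Subtype.ext ((hval a).symm.trans (this.trans (hval b)))
    · intro b
      exact ⟨⟨b.1, by rw [intervalObj_of_mem k hx]; trivial⟩, Subtype.ext (hval _)⟩
  refine ⟨fun h => ?_, ?_⟩
  · have h1 : (1 : k) ∈ intervalObj k I x₀ := by rw [intervalObj_of_mem k hx₀]; trivial
    have := h x₀
    exact one_ne_zero (congrArg Subtype.val
      (Subsingleton.elim (α := (interval k A I hI).obj x₀) ⟨1, h1⟩ 0))
  · rintro W₁ W₂ ⟨e⟩
    have hbij' : ∀ x ∈ I, ∀ y ∈ I, ∀ h : A.le y x,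
        Function.Bijective ((W₁.map h).prodMap (W₂.map h)) := by
      intro x hx y hy h
      have : ⇑((W₁.map h).prodMap (W₂.map h)) =
          e.equiv y ∘ (interval k A I hI).map h ∘ (e.equiv x).symm := by
        ext1 c
        have := e.comm h ((e.equiv x).symm c)
        exact (this.trans (congrArg ((W₁.prod W₂).map h) (LinearEquiv.apply_symm_apply _ c))).symm
      rw [this]
      exact (e.equiv y).bijective.comp ((hbij x hx y hy h).comp (e.equiv x).symm.bijective)
    have h₁ : ∀ x ∈ I, ∀ y ∈ I, A.zigzag.Arrow x y →
        Subsingleton (W₁.obj x) = Subsingleton (W₁.obj y) := by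
      intro x hx y hy h
      have := hbij' x hx y hy h
      rw [LinearMap.coe_prodMap, Function.Bijective, Prod.map_injective,
        Prod.map_surjective] at this
      exact propext (Equiv.ofBijective _ ⟨this.1.1, this.2.1⟩).subsingleton_congr
    have h₂ : ∀ x ∈ I, ∀ y ∈ I, A.zigzag.Arrow x y →
        Subsingleton (W₂.obj x) = Subsingleton (W₂.obj y) := by
      intro x hx y hy h
      have := hbij' x hx y hy h
      rw [LinearMap.coe_prodMap, Function.Bijective, Prod.map_injective,
        Prod.map_surjective] at this
      exact propext (Equiv.ofBijective _ ⟨this.1.2, this.2.2⟩).subsingleton_congr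
    have hout' : ∀ x ∉ I, Subsingleton (W₁.obj x × W₂.obj x) := fun x hx =>
      have := hout x hx
      (e.equiv x).symm.toEquiv.subsingleton
    rcases subsingleton_or_of_equiv_prod (e.equiv x₀) with h | h
    · refine Or.inl fun x => ?_
      by_cases hx : x ∈ I
      · rwa [A.zigzag.eq_of_arrow_eq hI (fun x => Subsingleton (W₁.obj x)) h₁ hx hx₀]
      · have := hout' x hx
        exact Function.Injective.subsingleton (f := fun a : W₁.obj x => (a, (0 : W₂.obj x)))
          fun a b h => congrArg Prod.fst h
    · refine Or.inr fun x => ?_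
      by_cases hx : x ∈ I
      · rwa [A.zigzag.eq_of_arrow_eq hI (fun x => Subsingleton (W₂.obj x)) h₂ hx hx₀]
      · have := hout' x hx
        exact Function.Injective.subsingleton (f := fun a : W₂.obj x => ((0 : W₁.obj x), a))
          fun a b h => congrArg Prod.snd h

/-- The map from the direct sum of the interval representations on the supports of the `s i` to `V`,
at the point `x`, that sends the generator of the `i`-th summand to `s i x`. -/
noncomputable def directSumIntervalMap (V : QuiverRep.{u, v} k A) {ι : Type} [DecidableEq ι]
    (s : ι → ∀ x, V.obj x) (x : ℝ) :
    (DirectSum ι fun i => intervalObj k {y | s i y ≠ 0} x) →ₗ[k] V.obj x :=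
  DirectSum.toModule k ι _ fun i =>
    LinearMap.toSpanSingleton k _ (s i x) ∘ₗ (intervalObj k {y | s i y ≠ 0} x).subtype

theorem directSumIntervalMap_lof (V : QuiverRep.{u, v} k A) {ι : Type} [DecidableEq ι]
    (s : ι → ∀ x, V.obj x) (x : ℝ) (i : ι) (a : intervalObj k {y | s i y ≠ 0} x) :
    V.directSumIntervalMap s x (DirectSum.lof k ι _ i a) = (a : k) • s i x := by
  simp [directSumIntervalMap]

theorem bijective_directSumIntervalMap (V : QuiverRep.{u, v} k A) {ι : Type} [DecidableEq ι]
    (s : ι → ∀ x, V.obj x) (x : ℝ) (hs : LinearIndepOn k (fun i => s i x) {i | s i x ≠ 0})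
    (hspan : Submodule.span k ((fun i => s i x) '' {i | s i x ≠ 0}) = ⊤) :
    Function.Bijective (V.directSumIntervalMap s x) := by
  constructor
  · rw [injective_iff_map_eq_zero]
    intro a ha
    refine DFinsupp.ext fun i => ?_
    by_cases hi : s i x ≠ 0
    · let b := Module.Basis.mk hs (by rw [image_eq_range] at hspan; exact hspan.ge)
      have hb : b.coord ⟨i, hi⟩ ∘ₗ V.directSumIntervalMap s x =
          (intervalObj k {y | s i y ≠ 0} x).subtype ∘ₗ DirectSum.component k ι _ i := by
        refine DirectSum.linearMap_ext k fun j => LinearMap.ext fun c => ?_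
        simp only [LinearMap.comp_apply, directSumIntervalMap_lof, map_smul]
        by_cases hj : s j x ≠ 0
        · have hbj : b ⟨j, hj⟩ = s j x := Module.Basis.mk_apply _ _ _
          rw [← hbj, Module.Basis.coord_apply, Module.Basis.repr_self]
          by_cases hij : j = i
          · subst hij
            simp [DirectSum.component.lof_self]
          · rw [DirectSum.component.of, dif_neg hij,
              Finsupp.single_eq_of_ne (by simpa using Ne.symm hij)]
            simp
        · have hij : j ≠ i := by rintro rfl; exact hj hi
          rw [DirectSum.component.of, dif_neg hij, not_not.1 hj]
          simp
      have := LinearMap.congr_fun hb a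
      rw [LinearMap.comp_apply, ha, map_zero] at this
      exact Subtype.ext this.symm
    · exact Subtype.ext (intervalObj_eq_zero k (I := {y | s i y ≠ 0}) hi (a i))
  · rw [← LinearMap.range_eq_top, eq_top_iff, ← hspan, Submodule.span_le]
    rintro _ ⟨i, hi, rfl⟩
    have h1 : (1 : k) ∈ intervalObj k {y | s i y ≠ 0} x := by
      rw [intervalObj_of_mem k (I := {y | s i y ≠ 0}) hi]; trivial
    exact ⟨DirectSum.lof k ι _ i ⟨1, h1⟩, by rw [directSumIntervalMap_lof, one_smul]⟩

theorem directSumIntervalMap_map (V : QuiverRep.{u, v} k A) {ι : Type} [DecidableEq ι]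
    (s : ι → ∀ x, V.obj x) (hs : ∀ i, V.toZigzagRep.IsIntervalSection (s i)) {x y : ℝ}
    (h : A.le y x) (a : DirectSum ι fun i => intervalObj k {z | s i z ≠ 0} x) :
    V.directSumIntervalMap s y ((directSum fun i =>
      interval k A {z | s i z ≠ 0} (hs i).ordConnected).map h a) =
      V.map h (V.directSumIntervalMap s x a) := by
  suffices H : V.directSumIntervalMap s y ∘ₗ
      (DFinsupp.mapRange.linearMap fun i => intervalMap k {z | s i z ≠ 0} x y) =
      V.map h ∘ₗ V.directSumIntervalMap s x from LinearMap.congr_fun H a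
  refine DirectSum.linearMap_ext k fun i => LinearMap.ext fun c => ?_
  have h1 : (DFinsupp.mapRange.linearMap fun i => intervalMap k {z | s i z ≠ 0} x y)
      (DirectSum.lof k ι _ i c) = DirectSum.lof k ι _ i (intervalMap k {z | s i z ≠ 0} x y c) :=
    DFinsupp.mapRange_single (hf := fun i => map_zero (intervalMap k {z | s i z ≠ 0} x y))
  rw [LinearMap.comp_apply, LinearMap.comp_apply, LinearMap.comp_apply, LinearMap.comp_apply, h1,
    directSumIntervalMap_lof, directSumIntervalMap_lof, map_smul, coe_intervalMap]
  by_cases hx : x ∈ {z | s i z ≠ 0}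
  · have : V.map h (s i x) = s i y := (hs i).isSection h (mem_univ _) (mem_univ _) hx
    rw [this]
    split_ifs with hxy
    · rfl
    · have hy : s i y = 0 := by
        by_contra hy
        exact hxy ⟨hx, hy⟩
      rw [hy, smul_zero, smul_zero]
  · rw [intervalObj_eq_zero k hx c, zero_smul, ite_self, zero_smul]

/-- Only finitely many members of `F` are nonzero at a given real number, so `F` can be indexed by
a type in the lowest universe. -/
theorem small_of_linearIndepOn (V : QuiverRep.{u, v} k A) (hV : V.IsPointwiseFinite)
    {F : Set (∀ x, V.obj x)} (hF : ∀ s ∈ F, ∃ x, s x ≠ 0)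
    (hli : ∀ x, LinearIndepOn k (fun s : ∀ x, V.obj x => s x) {s ∈ F | s x ≠ 0}) :
    Small.{0} F := by
  have hfin : ∀ x, Finite {s ∈ F | s x ≠ 0} := fun x =>
    have := hV x
    (LinearIndependent.finite (hli x))
  have hsub : F ⊆ ⋃ x : ℝ, {s ∈ F | s x ≠ 0} := fun s hs =>
    mem_iUnion.2 ((hF s hs).imp fun x hx => ⟨hs, hx⟩)
  exact small_subset hsub

end QuiverRep

theorem theorem2 {k : Type u} [Field k] (A : ContinuousQuiver) (V : QuiverRep.{u, v} k A)
    (hV : V.IsPointwiseFinite) :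
    ∃ (ι : Type) (I : ι → Set ℝ) (hI : ∀ i, (I i).OrdConnected),
      (∀ i, (I i).Nonempty) ∧
      (∀ i, (QuiverRep.interval k A (I i) (hI i)).IsIndecomposable) ∧
      Nonempty (V.Iso (QuiverRep.directSum fun i => QuiverRep.interval k A (I i) (hI i))) := by
  classical
  have hfd : ∀ x, FiniteDimensional k (V.toZigzagRep.obj x) := hV
  obtain ⟨F, hF, hbasis⟩ := V.toZigzagRep.exists_interval_basis
  have : Small.{0} F :=
    V.small_of_linearIndepOn hV (fun s hs => (hF s hs).nonempty) fun x => (hbasis x).1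
  let e : Shrink.{0} F ≃ F := (equivShrink F).symm
  let s : Shrink.{0} F → ∀ x, V.obj x := fun i => (e i).1
  have hs : ∀ i, V.toZigzagRep.IsIntervalSection (s i) := fun i => hF _ (e i).2
  have hbij : ∀ x, Function.Bijective (V.directSumIntervalMap s x) := by
    intro x
    have himage : s '' {i | s i x ≠ 0} = {t ∈ F | t x ≠ 0} := by
      ext t
      constructor
      · rintro ⟨i, hi, rfl⟩
        exact ⟨(e i).2, hi⟩
      · rintro ⟨ht, htx⟩
        have hst : s (e.symm ⟨t, ht⟩) = t := by simp [s]
        exact ⟨e.symm ⟨t, ht⟩, by rw [mem_ofPred_eq, hst]; exact htx, hst⟩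
    refine V.bijective_directSumIntervalMap s x ?_ ?_
    · have hinj : InjOn s {i | s i x ≠ 0} :=
        (Subtype.val_injective.comp e.injective).injOn
      have := (hbasis x).1
      rw [← himage] at this
      exact this.comp_of_image hinj
    · have := (hbasis x).2
      rwa [← himage, image_image] at this
  refine ⟨Shrink.{0} F, fun i => {x | s i x ≠ 0}, fun i => (hs i).ordConnected,
    fun i => (hs i).nonempty, fun i => QuiverRep.isIndecomposable_interval _ (hs i).nonempty,
    ⟨⟨fun x => (LinearEquiv.ofBijective _ (hbij x)).symm, fun {x y} h a => ?_⟩⟩⟩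
  refine (LinearEquiv.symm_apply_eq (LinearEquiv.ofBijective _ (hbij y))).2 ?_
  refine Eq.trans ?_ (V.directSumIntervalMap_map s hs h _).symm
  exact congrArg (V.map h)
    (LinearEquiv.apply_symm_apply (LinearEquiv.ofBijective _ (hbij x)) a).symm
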